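/- Let $L_2$ be the two-sorted language of second-order arithmetic, with number variables, set variables, the symbols $0,1,+,\cdot,\le$ on numbers, and $\in$ between numbers and sets. A formula is $\Sigma^0_n$ if it consists of $n$ alternating blocks of number quantifiers, the first existential, in front of a formula with only bounded number quantifiers; free set variables are allowed. Let $\mathsf{RCA}_0$ be the $L_2$-theory axiomatised by (i) the axioms saying that the number sort is the non-negative part of a discretely ordered ring, (ii) $\Delta^0_1$-comprehension: $\forall x\,(\varphi(x)\leftrightarrow\neg\psi(x))\to\exists X\,\forall x\,(x\in X\leftrightarrow\varphi(x))$ for $\Sigma^0_1$ formulas $\varphi,\psi$ with arbitrary number and set parameters, where $X$ does not occur in $\varphi$, and (iii) $\Sigma^0_1\text{-}\mathsf{IND}$, where $\Sigma^0_n\text{-}\mathsf{IND}$ is the scheme $\varphi(0)\wedge\forall x\,(\varphi(x)\to\varphi(x+1))\to\forall x\,\varphi(x)$ for $\Sigma^0_n$ formulas $\varphi$ with arbitrary number and set parameters. Let Bounded-width König's Lemma be the following $L_2$-sentence, where $\mathbb N$ denotes the number sort, finite sets are bounded sets, finite sequences are coded by numbers in the usual way, and infinite sequences are functions on $\mathbb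 N$ given by sets of coded pairs: for every finite set $Q$ and every directed graph $G$ whose vertices belong to $Q\times\mathbb N$ and whose edges are all of the form $((q,i),(q',i+1))$ with $q,q'\in Q$, and for every $q$, if for every $n$ there is a finite path in $G$ of length at least $n$ starting at $(q,0)$, then there is an infinite path in $G$ starting at $(q,0)$. Theorem. $\mathsf{RCA}_0+\Sigma^0_2\text{-}\mathsf{IND}$ implies Bounded-width König's Lemma; that is, Bounded-width König's Lemma is true in every model $(M,\mathcal S)$, $\mathcal S\subseteq\mathcal P(M)$, of $\mathsf{RCA}_0+\Sigma^0_2\text{-}\mathsf{IND}$. -/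

import Mathlib

universe u

namespace SOA

/-! ### The two-sorted language `L₂` of second-order arithmetic

Number variables and set variables are both named by (metatheoretic) natural numbers. -/

/-- Terms of the number sort. -/
inductive Term : Type
  | var (x : ℕ) : Term
  | zero : Term
  | one : Term
  | add (s t : Term) : Term
  | mul (s t : Term) : Term

instance : Zero Term := ⟨Term.zero⟩
instance : One Term := ⟨Term.one⟩
instance : Add Term := ⟨Term.add⟩
instance : Mul Term := ⟨Term.mul⟩

/-- Formulas of `L₂`. `mem t X` says that the number `t` belongs to the set variable `X`;
`all`, `ex` quantify over numbers and `allS`, `exS` quantify over sets. -/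
inductive Formula : Type
  | eq (s t : Term) : Formula
  | le (s t : Term) : Formula
  | mem (t : Term) (X : ℕ) : Formula
  | neg (φ : Formula) : Formula
  | and (φ ψ : Formula) : Formula
  | or (φ ψ : Formula) : Formula
  | imp (φ ψ : Formula) : Formula
  | all (x : ℕ) (φ : Formula) : Formula
  | ex (x : ℕ) (φ : Formula) : Formula
  | allS (X : ℕ) (φ : Formula) : Formula
  | exS (X : ℕ) (φ : Formula) : Formula

infix:60 " ≐ " => Formula.eq
infix:60 " ≼ " => Formula.le
infix:60 " ∈' " => Formula.mem
infixr:45 " ⋏ " => Formula.and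
infixr:42 " ⋎ " => Formula.or
infixr:40 " ⇒' " => Formula.imp

/-- Biconditional. -/
def Formula.iff (φ ψ : Formula) : Formula := (φ ⇒' ψ) ⋏ (ψ ⇒' φ)

/-- Strict order, `s ≤ t` and `s ≠ t`. -/
def Formula.lt (s t : Term) : Formula := s ≼ t ⋏ .neg (s ≐ t)

infix:60 " ≺ " => Formula.lt

/-- The variables of a term. -/
def Term.vars : Term → Finset ℕ
  | .var x => {x}
  | .zero => ∅
  | .one => ∅
  | .add s t => s.vars ∪ t.vars
  | .mul s t => s.vars ∪ t.vars

/-- All number variables (free or bound) occurring in a formula. -/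
def Formula.numVars : Formula → Finset ℕ
  | .eq s t => s.vars ∪ t.vars
  | .le s t => s.vars ∪ t.vars
  | .mem t _ => t.vars
  | .neg φ => φ.numVars
  | .and φ ψ => φ.numVars ∪ ψ.numVars
  | .or φ ψ => φ.numVars ∪ ψ.numVars
  | .imp φ ψ => φ.numVars ∪ ψ.numVars
  | .all x φ => insert x φ.numVars
  | .ex x φ => insert x φ.numVars
  | .allS _ φ => φ.numVars
  | .exS _ φ => φ.numVars

/-- All set variables (free or bound) occurring in a formula. -/
def Formula.setVars : Formula → Finset ℕ
  | .eq _ _ => ∅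
  | .le _ _ => ∅
  | .mem _ X => {X}
  | .neg φ => φ.setVars
  | .and φ ψ => φ.setVars ∪ ψ.setVars
  | .or φ ψ => φ.setVars ∪ ψ.setVars
  | .imp φ ψ => φ.setVars ∪ ψ.setVars
  | .all _ φ => φ.setVars
  | .ex _ φ => φ.setVars
  | .allS X φ => insert X φ.setVars
  | .exS X φ => insert X φ.setVars

/-! ### Structures and truth -/

/-- An `L₂`-structure `(M, 𝒮)`: a first-order structure `M` for `0, 1, +, ·, ≤` together with a
nonempty family `𝒮` of subsets of `M`, over which the set variables range. -/
structure L2Structure : Type (u + 1) where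
  carrier : Type u
  zero : carrier
  one : carrier
  add : carrier → carrier → carrier
  mul : carrier → carrier → carrier
  le : carrier → carrier → Prop
  sets : Set (Set carrier)
  sets_nonempty : sets.Nonempty

/-- Value of a term under an assignment of the number variables. -/
def L2Structure.eval (M : L2Structure.{u}) (e : ℕ → M.carrier) : Term → M.carrier
  | .var x => e x
  | .zero => M.zero
  | .one => M.one
  | .add s t => M.add (M.eval e s) (M.eval e t)
  | .mul s t => M.mul (M.eval e s) (M.eval e t)

/-- Tarski's truth definition: `e` assigns numbers, `E` assigns sets of the structure. -/
def L2Structure.Realize (M : L2Structure.{u}) :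
    Formula → (ℕ → M.carrier) → (ℕ → M.sets) → Prop
  | .eq s t, e, _ => M.eval e s = M.eval e t
  | .le s t, e, _ => M.le (M.eval e s) (M.eval e t)
  | .mem t X, e, E => M.eval e t ∈ (E X : Set M.carrier)
  | .neg φ, e, E => ¬ M.Realize φ e E
  | .and φ ψ, e, E => M.Realize φ e E ∧ M.Realize ψ e E
  | .or φ ψ, e, E => M.Realize φ e E ∨ M.Realize ψ e E
  | .imp φ ψ, e, E => M.Realize φ e E → M.Realize ψ e E
  | .all x φ, e, E => ∀ a : M.carrier, M.Realize φ (Function.update e x a) E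
  | .ex x φ, e, E => ∃ a : M.carrier, M.Realize φ (Function.update e x a) E
  | .allS X φ, e, E => ∀ A : M.sets, M.Realize φ e (Function.update E X A)
  | .exS X φ, e, E => ∃ A : M.sets, M.Realize φ e (Function.update E X A)

/-- A formula holds in `M` if it is true under all assignments (so its free variables, the
parameters, are read as universally quantified). -/
def L2Structure.Holds (M : L2Structure.{u}) (φ : Formula) : Prop :=
  ∀ (e : ℕ → M.carrier) (E : ℕ → M.sets), M.Realize φ e E

/-- `T` logically implies `φ`: `φ` holds in every model of `T`. -/
def Entails (T : Set Formula) (φ : Formula) : Prop :=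
  ∀ M : L2Structure.{u}, (∀ τ ∈ T, M.Holds τ) → M.Holds φ

/-! ### Quantifier hierarchy -/

/-- `Δ⁰₀` formulas: only bounded number quantifiers `∀ x ≤ t`, `∃ x ≤ t` (with `x` not in `t`)
and no set quantifiers; set variables may occur free. -/
inductive IsDelta0 : Formula → Prop
  | eq (s t : Term) : IsDelta0 (s ≐ t)
  | le (s t : Term) : IsDelta0 (s ≼ t)
  | mem (t : Term) (X : ℕ) : IsDelta0 (t ∈' X)
  | neg {φ : Formula} : IsDelta0 φ → IsDelta0 (.neg φ)
  | and {φ ψ : Formula} : IsDelta0 φ → IsDelta0 ψ → IsDelta0 (φ ⋏ ψ)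
  | or {φ ψ : Formula} : IsDelta0 φ → IsDelta0 ψ → IsDelta0 (φ ⋎ ψ)
  | imp {φ ψ : Formula} : IsDelta0 φ → IsDelta0 ψ → IsDelta0 (φ ⇒' ψ)
  | ball {x : ℕ} {t : Term} {φ : Formula} :
      x ∉ t.vars → IsDelta0 φ → IsDelta0 (.all x (.var x ≼ t ⇒' φ))
  | bex {x : ℕ} {t : Term} {φ : Formula} :
      x ∉ t.vars → IsDelta0 φ → IsDelta0 (.ex x (.var x ≼ t ⋏ φ))

mutual
/-- `Σ⁰ₙ` formulas: `n` alternating blocks of number quantifiers, starting with `∃`, in front of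
a `Δ⁰₀` formula. -/
inductive IsSigma : ℕ → Formula → Prop
  | delta0 {φ : Formula} : IsDelta0 φ → IsSigma 0 φ
  | of_pi {n : ℕ} {φ : Formula} : IsPi n φ → IsSigma (n + 1) φ
  | ex {n : ℕ} {φ : Formula} (x : ℕ) : IsSigma (n + 1) φ → IsSigma (n + 1) (.ex x φ)
/-- `Π⁰ₙ` formulas: the same, starting with `∀`. -/
inductive IsPi : ℕ → Formula → Prop
  | delta0 {φ : Formula} : IsDelta0 φ → IsPi 0 φ
  | of_sigma {n : ℕ} {φ : Formula} : IsSigma n φ → IsPi (n + 1) φ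
  | all {n : ℕ} {φ : Formula} (x : ℕ) : IsPi (n + 1) φ → IsPi (n + 1) (.all x φ)
end

/-! ### Axioms -/

section
open Term (var)

/-- The number sort is the non-negative part of a discretely ordered ring. -/
def basicAxioms : Set Formula :=
  { (var 0 + var 1) + var 2 ≐ var 0 + (var 1 + var 2),
    var 0 + var 1 ≐ var 1 + var 0,
    (var 0 * var 1) * var 2 ≐ var 0 * (var 1 * var 2),
    var 0 * var 1 ≐ var 1 * var 0,
    var 0 * (var 1 + var 2) ≐ var 0 * var 1 + var 0 * var 2,
    var 0 + 0 ≐ var 0,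
    var 0 * 0 ≐ 0,
    var 0 * 1 ≐ var 0,
    var 0 ≼ var 0,
    var 0 ≼ var 1 ⋏ var 1 ≼ var 0 ⇒' var 0 ≐ var 1,
    var 0 ≼ var 1 ⋏ var 1 ≼ var 2 ⇒' var 0 ≼ var 2,
    var 0 ≼ var 1 ⋎ var 1 ≼ var 0,
    var 0 ≺ var 1 ⇒' var 0 + var 2 ≺ var 1 + var 2,
    0 ≺ var 2 ⋏ var 0 ≺ var 1 ⇒' var 0 * var 2 ≺ var 1 * var 2,
    var 0 ≼ var 1 ⇒' .ex 2 (var 0 + var 2 ≐ var 1),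
    0 ≼ var 0,
    0 ≺ 1,
    0 ≺ var 0 ⇒' 1 ≼ var 0 }

/-- The induction axiom for `φ` in the variable `x`:
`φ(0) ∧ ∀ x (φ(x) → φ(x + 1)) → ∀ x φ(x)`.
Here `φ(0)` is written `∀ x (x = 0 → φ)`, and `φ(x + 1)` is written
`∀ y (y = x + 1 → ∀ x (x = y → φ))` with `y` a variable that does not occur in `φ`. -/
def inductionAxiom (x y : ℕ) (φ : Formula) : Formula :=
  .all x (var x ≐ 0 ⇒' φ) ⋏
    .all x (φ ⇒' .all y (var y ≐ var x + 1 ⇒' .all x (var x ≐ var y ⇒' φ)))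
  ⇒' .all x φ

/-- The scheme `Σ⁰ₙ-IND` (with arbitrary number and set parameters). -/
def sigmaInd (n : ℕ) : Set Formula :=
  { θ | ∃ (φ : Formula) (x y : ℕ), IsSigma n φ ∧ y ≠ x ∧ y ∉ φ.numVars ∧
      θ = inductionAxiom x y φ }

/-- The scheme of `Δ⁰₁`-comprehension:
`∀ x (φ(x) ↔ ¬ ψ(x)) → ∃ X ∀ x (x ∈ X ↔ φ(x))` for `φ, ψ` in `Σ⁰₁`, `X` not in `φ`. -/
def delta1Comprehension : Set Formula :=
  { θ | ∃ (φ ψ : Formula) (x X : ℕ), IsSigma 1 φ ∧ IsSigma 1 ψ ∧ X ∉ φ.setVars ∧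
      θ = (.all x (φ.iff (.neg ψ)) ⇒' .exS X (.all x ((var x ∈' X).iff φ))) }

/-- The theory `RCA₀`. -/
def RCA0 : Set Formula := basicAxioms ∪ delta1Comprehension ∪ sigmaInd 1

/-! ### Bounded-width König's Lemma as an `L₂`-sentence

Pairs are coded by `(s, t) = (s + t)² + s`. A finite set is a bounded set. A finite sequence of
numbers is coded by a pair of numbers through Gödel's β-function. An infinite sequence is a set
of pairs that is the graph of a function. -/

/-- The pair `(s, t)`. -/
def pair (s t : Term) : Term := (s + t) * (s + t) + s

/-- `v` is the `i`-th entry of the sequence coded by `c, d`, that is, `v` is the remainder of `c`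
modulo `1 + (i + 1) d`. The bound variable `k` must not occur in the terms. -/
def entry (k : ℕ) (c d i v : Term) : Formula :=
  v ≺ 1 + (i + 1) * d ⋏ .ex k (c ≐ var k * (1 + (i + 1) * d) + v)

/-- The set `Q` is finite. -/
def finiteSet (Q : ℕ) : Formula :=
  .ex 0 (.all 1 (var 1 ∈' Q ⇒' var 1 ≼ var 0))

/-- `V` and `E` are the vertex set and the edge set of a directed graph whose vertices belong to
`Q × ℕ` and whose edges are all of the form `((q, i), (q', i + 1))`. -/
def levelGraph (Q V E : ℕ) : Formula :=
  .all 0 (var 0 ∈' V ⇒' .ex 1 (.ex 2 (var 1 ∈' Q ⋏ var 0 ≐ pair (var 1) (var 2)))) ⋏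
  .all 0 (var 0 ∈' E ⇒' .ex 1 (.ex 2 (.ex 3
    (pair (var 1) (var 3) ∈' V ⋏ pair (var 2) (var 3 + 1) ∈' V ⋏
      var 0 ≐ pair (pair (var 1) (var 3)) (pair (var 2) (var 3 + 1))))))

/-- There are arbitrarily long finite paths from `(q, 0)`, where `q` is the number variable `0`:
for every `n` (variable `1`) there are `m ≥ n` (variable `2`) and a sequence with code `c, d`
(variables `3, 4`) whose entries with indices `0, …, m` form a path starting at `(q, 0)`. -/
def longPaths (V E : ℕ) : Formula :=
  .all 1 (.ex 2 (.ex 3 (.ex 4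
    (var 1 ≼ var 2 ⋏
     pair (var 0) 0 ∈' V ⋏
     entry 8 (var 3) (var 4) 0 (pair (var 0) 0) ⋏
     .all 5 (var 5 ≺ var 2 ⇒' .ex 6 (.ex 7
       (entry 8 (var 3) (var 4) (var 5) (var 6) ⋏
        entry 8 (var 3) (var 4) (var 5 + 1) (var 7) ⋏
        pair (var 6) (var 7) ∈' E)))))))

/-- `P` is (the graph of) a function from `ℕ` to `ℕ`. -/
def isFunction (P : ℕ) : Formula :=
  .all 1 (var 1 ∈' P ⇒' .ex 2 (.ex 3 (var 1 ≐ pair (var 2) (var 3)))) ⋏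
  .all 1 (.ex 2 (pair (var 1) (var 2) ∈' P)) ⋏
  .all 1 (.all 2 (.all 3
    (pair (var 1) (var 2) ∈' P ⋏ pair (var 1) (var 3) ∈' P ⇒' var 2 ≐ var 3)))

/-- `P` is an infinite path `v₀, v₁, …` with `v₀ = (q, 0)`, where `q` is the number
variable `0`. -/
def infinitePath (E P : ℕ) : Formula :=
  isFunction P ⋏
  pair 0 (pair (var 0) 0) ∈' P ⋏
  .all 1 (.all 2 (.all 3
    (pair (var 1) (var 2) ∈' P ⋏ pair (var 1 + 1) (var 3) ∈' P ⇒'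
      pair (var 2) (var 3) ∈' E)))

/-- Bounded-width König's Lemma, with set variables `Q = 0`, `V = 1`, `E = 2`, `P = 3`. -/
def boundedWidthKonig : Formula :=
  .allS 0 (.allS 1 (.allS 2
    (finiteSet 0 ⋏ levelGraph 0 1 2 ⇒'
      .all 0 (longPaths 1 2 ⇒' .exS 3 (infinitePath 2 3)))))

end

end SOA

namespace SOA

/-! ### Semantic quantifier classes with parameters -/

section Classes

variable {M : Type u}

-- For j ≤ n let T(j,n) be the set of q ≤ b from which a path leads from (q,j) to level n. These
-- sets shrink as n grows, and T(j,n) is determined by T(i,n) whenever j ≤ i ≤ n. A vertex is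
-- extendible if it reaches every level. Extendibility is visibly Π⁰₁; the crux is to make it Δ⁰₁,
-- after which an infinite path arises by always moving to the least extendible successor.
--
-- `Model.exists_code` provides one d whose moduli code all Δ⁰₀ subsets of [0,b] by divisibility.
-- The least common multiple of the moduli indexed by a set determines that set, and here it plays
-- the role of cardinality. By Σ⁰₂ induction (`Model.exists_least_multiple`) there are m and l such
-- that no T(i,n) with l ≤ i ≤ n has a common multiple below m, while for cofinally many i some
-- T(i,n) has least common multiple exactly m. For such a pair and n' ≥ n, the set T(i,n') is
-- contained in T(i,n), so m is a common multiple for it too, and again the least; hence both sets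
-- are equal. Thus T(i,n) has stabilised, and so has T(j,n) for every j ≤ i. Therefore (q,j) is
-- extendible iff some such pair with i ≥ j has q in T(j,n), which is a Σ⁰₁ condition. A pair found
-- for level j + 1 also shows that an extendible vertex at level j has an extendible successor
-- (`Model.exists_extendible`).
--
-- The sets T and the final path are obtained from Σ⁰₁ induction and Δ⁰₁ comprehension through the
-- recursion principle `Model.exists_rec`. The argument takes place in an ordered semiring M with a
-- family S of subsets; complexity is tracked by type classes, so that instance search checks it. A
-- hypothesis that P stays Δ⁰₀ after substituting any polynomials serves as a local instance. The
-- last part converts semantic classes to formulas and back.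

/-- Polynomial functions of `n` variables, with coefficients in `M`. -/
class inductive Poly [Add M] [Mul M] : {n : ℕ} → ((Fin n → M) → M) → Prop
  | var {n : ℕ} (i : Fin n) : Poly (fun v => v i)
  | const {n : ℕ} (c : M) : Poly (fun _ : Fin n → M => c)
  | add {n : ℕ} {f g : (Fin n → M) → M} (hf : Poly f) (hg : Poly g) : Poly (fun v => f v + g v)
  | mul {n : ℕ} {f g : (Fin n → M) → M} (hf : Poly f) (hg : Poly g) : Poly (fun v => f v * g v)

attribute [instance] Poly.var Poly.const

instance {n : ℕ} [Add M] [Mul M] {f g : (Fin n → M) → M} [hf : Poly f] [hg : Poly g] :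
    Poly (fun v => f v + g v) := .add hf hg

instance {n : ℕ} [Add M] [Mul M] {f g : (Fin n → M) → M} [hf : Poly f] [hg : Poly g] :
    Poly (fun v => f v * g v) := .mul hf hg

/-- Used for weakening: under a quantifier the old arguments appear through `Fin.castSucc`. -/
instance Poly.rename {n m : ℕ} [Add M] [Mul M] {f : (Fin n → M) → M} (σ : Fin n → Fin m)
    [hf : Poly f] : Poly (fun w : Fin m → M => f (fun i => w (σ i))) := by
  induction hf with
  | var i => exact .var _
  | const c => exact .const c
  | add _ _ ihf ihg => exact .add ihf ihg
  | mul _ _ ihf ihg => exact .mul ihf ihg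

/-- `Δ⁰₀` relations, with number parameters from `M` and set parameters from `S`. -/
class inductive Delta0 [Add M] [Mul M] [LE M] (S : Set (Set M)) :
    {n : ℕ} → ((Fin n → M) → Prop) → Prop
  | eq {n : ℕ} {f g : (Fin n → M) → M} (hf : Poly f) (hg : Poly g) : Delta0 S (fun v => f v = g v)
  | le {n : ℕ} {f g : (Fin n → M) → M} (hf : Poly f) (hg : Poly g) : Delta0 S (fun v => f v ≤ g v)
  | mem {n : ℕ} {f : (Fin n → M) → M} (X : S) (hf : Poly f) : Delta0 S (fun v => f v ∈ (X : Set M))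
  | not {n : ℕ} {P : (Fin n → M) → Prop} (hP : Delta0 S P) : Delta0 S (fun v => ¬ P v)
  | and {n : ℕ} {P Q : (Fin n → M) → Prop} (hP : Delta0 S P) (hQ : Delta0 S Q) :
      Delta0 S (fun v => P v ∧ Q v)
  | or {n : ℕ} {P Q : (Fin n → M) → Prop} (hP : Delta0 S P) (hQ : Delta0 S Q) :
      Delta0 S (fun v => P v ∨ Q v)
  | imp {n : ℕ} {P Q : (Fin n → M) → Prop} (hP : Delta0 S P) (hQ : Delta0 S Q) :
      Delta0 S (fun v => P v → Q v)
  | ball {n : ℕ} {t : (Fin n → M) → M} {P : (Fin n → M) → M → Prop} (ht : Poly t)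
      (hP : Delta0 S (fun w : Fin (n + 1) → M => P (fun i => w i.castSucc) (w (Fin.last n)))) :
      Delta0 S (fun v => ∀ a, a ≤ t v → P v a)
  | bex {n : ℕ} {t : (Fin n → M) → M} {P : (Fin n → M) → M → Prop} (ht : Poly t)
      (hP : Delta0 S (fun w : Fin (n + 1) → M => P (fun i => w i.castSucc) (w (Fin.last n)))) :
      Delta0 S (fun v => ∃ a, a ≤ t v ∧ P v a)

instance {n : ℕ} [Add M] [Mul M] [LE M] {S : Set (Set M)}
    {f g : (Fin n → M) → M} [hf : Poly f] [hg : Poly g] :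
    Delta0 S (fun v => f v = g v) := .eq hf hg

instance {n : ℕ} [Add M] [Mul M] [LE M] {S : Set (Set M)}
    {f g : (Fin n → M) → M} [hf : Poly f] [hg : Poly g] :
    Delta0 S (fun v => f v ≤ g v) := .le hf hg

instance {n : ℕ} [Add M] [Mul M] [LE M] {S : Set (Set M)}
    {f : (Fin n → M) → M} (X : S) [hf : Poly f] :
    Delta0 S (fun v => f v ∈ (X : Set M)) := .mem X hf

instance {n : ℕ} [Add M] [Mul M] [LE M] {S : Set (Set M)}
    {P : (Fin n → M) → Prop} [hP : Delta0 S P] :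
    Delta0 S (fun v => ¬ P v) := .not hP

instance {n : ℕ} [Add M] [Mul M] [LE M] {S : Set (Set M)}
    {P Q : (Fin n → M) → Prop} [hP : Delta0 S P] [hQ : Delta0 S Q] :
    Delta0 S (fun v => P v ∧ Q v) := .and hP hQ

instance {n : ℕ} [Add M] [Mul M] [LE M] {S : Set (Set M)}
    {P Q : (Fin n → M) → Prop} [hP : Delta0 S P] [hQ : Delta0 S Q] :
    Delta0 S (fun v => P v ∨ Q v) := .or hP hQ

instance {n : ℕ} [Add M] [Mul M] [LE M] {S : Set (Set M)}
    {P Q : (Fin n → M) → Prop} [hP : Delta0 S P] [hQ : Delta0 S Q] :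
    Delta0 S (fun v => P v → Q v) := .imp hP hQ

instance {n : ℕ} [Add M] [Mul M] [LE M] {S : Set (Set M)}
    {t : (Fin n → M) → M} {P : (Fin n → M) → M → Prop}
    [ht : Poly t]
    [hP : Delta0 S (fun w : Fin (n + 1) → M => P (fun i => w i.castSucc) (w (Fin.last n)))] :
    Delta0 S (fun v => ∀ a, a ≤ t v → P v a) := .ball ht hP

instance {n : ℕ} [Add M] [Mul M] [LE M] {S : Set (Set M)}
    {t : (Fin n → M) → M} {P : (Fin n → M) → M → Prop}
    [ht : Poly t]
    [hP : Delta0 S (fun w : Fin (n + 1) → M => P (fun i => w i.castSucc) (w (Fin.last n)))] :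
    Delta0 S (fun v => ∃ a, a ≤ t v ∧ P v a) := .bex ht hP

/-- `Σ⁰₁` relations with parameters. -/
class inductive Sigma1 [Add M] [Mul M] [LE M] (S : Set (Set M)) :
    {n : ℕ} → ((Fin n → M) → Prop) → Prop
  | delta0 {n : ℕ} {P : (Fin n → M) → Prop} (hP : Delta0 S P) : Sigma1 S P
  | ex {n : ℕ} {P : (Fin n → M) → M → Prop}
      (hP : Sigma1 S (fun w : Fin (n + 1) → M => P (fun i => w i.castSucc) (w (Fin.last n)))) :
      Sigma1 S (fun v => ∃ a, P v a)

instance {n : ℕ} [Add M] [Mul M] [LE M] {S : Set (Set M)}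
    {P : (Fin n → M) → Prop} [hP : Delta0 S P] :
    Sigma1 S P := .delta0 hP

instance {n : ℕ} [Add M] [Mul M] [LE M] {S : Set (Set M)}
    {P : (Fin n → M) → M → Prop}
    [hP : Sigma1 S (fun w : Fin (n + 1) → M => P (fun i => w i.castSucc) (w (Fin.last n)))] :
    Sigma1 S (fun v => ∃ a, P v a) := .ex hP

/-- `Π⁰₁` relations with parameters. -/
class inductive Pi1 [Add M] [Mul M] [LE M] (S : Set (Set M)) :
    {n : ℕ} → ((Fin n → M) → Prop) → Prop
  | delta0 {n : ℕ} {P : (Fin n → M) → Prop} (hP : Delta0 S P) : Pi1 S P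
  | all {n : ℕ} {P : (Fin n → M) → M → Prop}
      (hP : Pi1 S (fun w : Fin (n + 1) → M => P (fun i => w i.castSucc) (w (Fin.last n)))) :
      Pi1 S (fun v => ∀ a, P v a)

instance {n : ℕ} [Add M] [Mul M] [LE M] {S : Set (Set M)}
    {P : (Fin n → M) → Prop} [hP : Delta0 S P] :
    Pi1 S P := .delta0 hP

instance {n : ℕ} [Add M] [Mul M] [LE M] {S : Set (Set M)}
    {P : (Fin n → M) → M → Prop}
    [hP : Pi1 S (fun w : Fin (n + 1) → M => P (fun i => w i.castSucc) (w (Fin.last n)))] :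
    Pi1 S (fun v => ∀ a, P v a) := .all hP

/-- `Σ⁰₂` relations with parameters. -/
class inductive Sigma2 [Add M] [Mul M] [LE M] (S : Set (Set M)) :
    {n : ℕ} → ((Fin n → M) → Prop) → Prop
  | pi1 {n : ℕ} {P : (Fin n → M) → Prop} (hP : Pi1 S P) : Sigma2 S P
  | ex {n : ℕ} {P : (Fin n → M) → M → Prop}
      (hP : Sigma2 S (fun w : Fin (n + 1) → M => P (fun i => w i.castSucc) (w (Fin.last n)))) :
      Sigma2 S (fun v => ∃ a, P v a)

instance {n : ℕ} [Add M] [Mul M] [LE M] {S : Set (Set M)}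
    {P : (Fin n → M) → Prop} [hP : Pi1 S P] :
    Sigma2 S P := .pi1 hP

instance {n : ℕ} [Add M] [Mul M] [LE M] {S : Set (Set M)}
    {P : (Fin n → M) → M → Prop}
    [hP : Sigma2 S (fun w : Fin (n + 1) → M => P (fun i => w i.castSucc) (w (Fin.last n)))] :
    Sigma2 S (fun v => ∃ a, P v a) := .ex hP

end Classes

/-- Semantic form of `RCA₀ + Σ⁰₂-IND` for a family `S` of subsets of an ordered semiring `M`. -/
structure Model (M : Type u) [CommSemiring M] [LinearOrder M] (S : Set (Set M)) : Prop where
  one_le : ∀ x : M, 0 < x → 1 ≤ x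
  comp : ∀ P : M → Prop, Sigma1 S (fun v : Fin 1 → M => P (v 0)) →
    Sigma1 S (fun v : Fin 1 → M => ¬ P (v 0)) → ∃ X : S, ∀ x, x ∈ (X : Set M) ↔ P x
  ind1 : ∀ P : M → Prop, Sigma1 S (fun v : Fin 1 → M => P (v 0)) → P 0 →
    (∀ x, P x → P (x + 1)) → ∀ x, P x
  ind2 : ∀ P : M → Prop, Sigma2 S (fun v : Fin 1 → M => P (v 0)) → P 0 →
    (∀ x, P x → P (x + 1)) → ∀ x, P x

-- Order, divisibility and pairing in a discretely ordered semiring.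

section Arithmetic

variable {M : Type u} [CommSemiring M] [LinearOrder M] [IsStrictOrderedRing M]
  [CanonicallyOrderedAdd M] {S : Set (Set M)}

instance Delta0.lt {n : ℕ} {f g : (Fin n → M) → M} [Poly f] [Poly g] :
    Delta0 S (fun v => f v < g v) := by
  have : (fun v => f v < g v) = fun v => ¬ g v ≤ f v := by
    funext v; simp
  rw [this]; infer_instance

theorem le_mul_of_eq_mul {a b k : M} (h : a = b * k) (hb : b ≠ 0)
    (hM : ∀ x : M, 0 < x → 1 ≤ x) : k ≤ a := by
  have : 1 ≤ b := hM b (pos_iff_ne_zero.2 hb)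
  rw [h]; exact le_mul_of_one_le_left (zero_le) this

/-- Divisibility with a bounded witness, a `Δ⁰₀` form of `a ∣ b`. -/
def BDvd (a b : M) : Prop := ∃ k, k ≤ b ∧ b = a * k

instance Delta0.bdvd {n : ℕ} {f g : (Fin n → M) → M} [Poly f] [Poly g] :
    Delta0 S (fun v => BDvd (f v) (g v)) := by
  unfold BDvd; infer_instance

theorem Model.bdvd_iff (hM : Model M S) {a b : M} : BDvd a b ↔ a ∣ b := by
  constructor
  · rintro ⟨k, -, h⟩; exact ⟨k, h⟩
  · rintro ⟨k, h⟩
    by_cases ha : a = 0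
    · exact ⟨0, zero_le, by simp [h, ha]⟩
    · exact ⟨k, le_mul_of_eq_mul h ha hM.one_le, h⟩

theorem Model.lt_add_one_iff (hM : Model M S) {a b : M} : a < b + 1 ↔ a ≤ b := by
  constructor
  · intro h
    by_contra! hb
    obtain ⟨c, rfl⟩ := exists_add_of_le hb.le
    have : 0 < c := by
      rw [pos_iff_ne_zero]; rintro rfl; simp at hb
    exact absurd h (not_lt.2 (by gcongr; exact hM.one_le c this))
  · intro h; exact lt_of_le_of_lt h (lt_add_one b)

theorem Model.add_one_le_iff (hM : Model M S) {a b : M} : a + 1 ≤ b ↔ a < b := by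
  rw [← not_lt, hM.lt_add_one_iff, not_le]

theorem Model.le_sq (hM : Model M S) (a : M) : a ≤ a * a := by
  by_cases ha : a = 0
  · simp [ha]
  · exact le_mul_of_one_le_left (zero_le) (hM.one_le a (pos_iff_ne_zero.2 ha))

/-- There is no subtraction, so the two quotients are compared: either their difference is the
quotient of c, or c is forced to be 0. -/
theorem dvd_of_dvd_add {a b c : M} (h : a ∣ b + c) (hb : a ∣ b) : a ∣ c := by
  obtain ⟨u, rfl⟩ := hb
  obtain ⟨v, hv⟩ := h
  rcases le_total u v with huv | huv
  · obtain ⟨w, rfl⟩ := exists_add_of_le huv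
    exact ⟨w, by rw [mul_add] at hv; exact add_left_cancel hv⟩
  · obtain ⟨w, rfl⟩ := exists_add_of_le huv
    have h0 : a * v + (a * w + c) = a * v + 0 := by rw [← add_assoc, ← mul_add, hv, add_zero]
    have := add_left_cancel h0
    rw [add_eq_zero] at this
    simp [this.2]

/-- The code `(s + t)² + s` of a pair. -/
def pr (s t : M) : M := (s + t) * (s + t) + s

instance Poly.pr {n : ℕ} {f g : (Fin n → M) → M} [Poly f] [Poly g] :
    Poly (fun v => pr (f v) (g v)) := by
  unfold SOA.pr; infer_instance

/-- The code lies between (s + t)² and (s + t + 1)², strictly below the latter, so the sum s + t can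
be recovered from it. -/
theorem Model.pr_lt (hM : Model M S) {s t s' t' : M} (h : s + t < s' + t') :
    pr s t < pr s' t' := by
  have h1 : s + t + 1 ≤ s' + t' := hM.add_one_le_iff.2 h
  calc pr s t ≤ (s + t) * (s + t) + (s + t) := by unfold pr; gcongr; simp
    _ ≤ (s + t) * (s + t) + (s + t) + (s + t) := by simp
    _ < (s + t) * (s + t) + (s + t) + (s + t) + 1 := lt_add_one _
    _ = (s + t + 1) * (s + t + 1) := by ring
    _ ≤ (s' + t') * (s' + t') := by gcongr
    _ ≤ pr s' t' := by unfold pr; simp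

theorem Model.pr_inj (hM : Model M S) {s t s' t' : M} :
    pr s t = pr s' t' ↔ s = s' ∧ t = t' := by
  refine ⟨fun h => ?_, fun h => by rw [h.1, h.2]⟩
  rcases lt_trichotomy (s + t) (s' + t') with h1 | h1 | h1
  · exact absurd h (hM.pr_lt h1).ne
  · unfold pr at h
    rw [h1] at h
    have h2 := add_left_cancel h
    subst h2
    exact ⟨rfl, add_left_cancel h1⟩
  · exact absurd h (hM.pr_lt h1).ne'

theorem left_le_pr (s t : M) : s ≤ pr s t := by unfold pr; simp

theorem Model.right_le_pr (hM : Model M S) (s t : M) : t ≤ pr s t :=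
  calc t ≤ s + t := by simp
    _ ≤ (s + t) * (s + t) := hM.le_sq _
    _ ≤ pr s t := by unfold pr; simp

theorem pr_mono {s t s' t' : M} (hs : s ≤ s') (ht : t ≤ t') : pr s t ≤ pr s' t' := by
  unfold pr; gcongr

/-- Downward induction for `Δ⁰₀` properties. -/
theorem Model.down_ind (hM : Model M S) (n : M) (P : M → Prop)
    (hP : ∀ {k : ℕ} (f : (Fin k → M) → M) [Poly f], Delta0 S (fun v => P (f v)))
    (hn : P n) (hs : ∀ j, j < n → P (j + 1) → P j) : ∀ j, j ≤ n → P j := by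
  -- Ordinary induction on x = n - j, written additively; the bound on j keeps the statement Δ⁰₀.
  have key : ∀ x, ∀ j, j ≤ n → x + j = n → P j := by
    refine hM.ind1 _ inferInstance ?_ ?_
    · rintro j - rfl; simpa using hn
    · intro x ih j hj hxj
      have hlt : j < n := by
        rw [← hM.add_one_le_iff, ← hxj, add_comm j 1]
        gcongr
        simp
      exact hs j hlt (ih (j + 1) (hM.add_one_le_iff.2 hlt) (by rw [← hxj]; ring))
  intro j hj
  obtain ⟨x, hx⟩ := exists_add_of_le hj
  exact key x j hj (by rw [hx, add_comm])

end Arithmetic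

-- Coding bounded sets by divisibility, comprehension and recursion.

section Coding

variable {M : Type u} [CommSemiring M] [LinearOrder M] [IsStrictOrderedRing M]
  [CanonicallyOrderedAdd M] {S : Set (Set M)}

instance Delta0.iff {n : ℕ} {P Q : (Fin n → M) → Prop} [Delta0 S P] [Delta0 S Q] :
    Delta0 S (fun v => (P v ↔ Q v)) := by
  simp only [iff_def]; infer_instance

/-- Multiply the terms one by one. The general progression covers both the successors z + 1 (a = 0,
k = 1) and the β-moduli (a = 1, k = d). -/
theorem Model.exists_common_multiple (hM : Model M S) (a k : M) (h : 0 < a + k) (N : M) :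
    ∃ B, 0 < B ∧ ∀ z, z ≤ N → BDvd (a + (z + 1) * k) B := by
  revert N
  have hpos : ∀ z, 0 < a + (z + 1) * k := fun z => lt_of_lt_of_le h (by
    gcongr; exact le_mul_of_one_le_left (zero_le) (by simp))
  refine hM.ind1 _ inferInstance ?_ ?_
  · refine ⟨a + k, h, fun z hz => ?_⟩
    rw [hM.bdvd_iff, nonpos_iff_eq_zero.1 hz]
    simp
  · rintro N ⟨B, hB, hN⟩
    refine ⟨B * (a + (N + 1 + 1) * k), mul_pos hB (hpos _), fun z hz => ?_⟩
    rw [hM.bdvd_iff]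
    rcases hz.lt_or_eq with hz | rfl
    · exact Dvd.dvd.mul_right (hM.bdvd_iff.1 (hN z (hM.lt_add_one_iff.1 hz))) _
    · exact dvd_mul_left _ _

/-- The moduli of Gödel's β-function. -/
def modulus (d z : M) : M := 1 + (z + 1) * d

instance Poly.modulus {n : ℕ} {f g : (Fin n → M) → M} [Poly f] [Poly g] :
    Poly (fun v => modulus (f v) (g v)) := by
  unfold SOA.modulus; infer_instance

/-- Modulo `modulus d z` the number (z + 1)d is -1, hence cancellable. -/
theorem modulus_dvd_of_dvd_mul_self {d z c : M} (h : modulus d z ∣ c * ((z + 1) * d)) :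
    modulus d z ∣ c := by
  refine dvd_of_dvd_add (b := c * ((z + 1) * d)) ?_ h
  exact ⟨c, by unfold modulus; ring⟩

/-- Distinct moduli with small indices are coprime, in the form of Euclid's lemma. -/
theorem modulus_dvd_of_dvd_mul {d N z y c : M}
    (hd : ∀ t, 0 < t → t ≤ N → t ∣ d) (hz : z ≤ N) (hy : y ≤ N) (hne : z ≠ y)
    (h : modulus d z ∣ c * modulus d y) : modulus d z ∣ c := by
  -- Two moduli differ by t·d with 0 < t ≤ N. First d is cancelled, being invertible; then t,
  -- because t divides d.
  have key : ∀ t, 0 < t → t ≤ N → modulus d z ∣ c * (t * d) → modulus d z ∣ c := by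
    intro t ht htN h
    have h1 : modulus d z ∣ c * t := by
      apply modulus_dvd_of_dvd_mul_self
      have := h.mul_right (z + 1)
      rwa [show c * (t * d) * (z + 1) = c * t * ((z + 1) * d) by ring] at this
    obtain ⟨e, rfl⟩ := hd t ht htN
    apply modulus_dvd_of_dvd_mul_self
    have := h1.mul_right (e * (z + 1))
    rwa [show c * t * (e * (z + 1)) = c * ((z + 1) * (t * e)) by ring] at this
  rcases hne.lt_or_gt with hlt | hlt
  · obtain ⟨t, rfl⟩ := exists_add_of_le hlt.le
    have ht : 0 < t := by rw [pos_iff_ne_zero]; rintro rfl; simp at hlt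
    refine key t ht (le_trans (by simp) hy) (dvd_of_dvd_add (b := c * modulus d z) ?_ (by simp))
    rwa [show c * modulus d z + c * (t * d) = c * modulus d (z + t) by unfold modulus; ring]
  · obtain ⟨t, rfl⟩ := exists_add_of_le hlt.le
    have ht : 0 < t := by rw [pos_iff_ne_zero]; rintro rfl; simp at hlt
    refine key t ht (le_trans (by simp) hz) (dvd_of_dvd_add (b := c * modulus d y) ?_ h)
    rw [show c * modulus d y + c * (t * d) = c * modulus d (y + t) by unfold modulus; ring]
    simp

theorem one_lt_modulus {d : M} (hd : 0 < d) (z : M) : 1 < modulus d z := by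
  unfold modulus
  have : 0 < (z + 1) * d := by positivity
  exact lt_add_of_pos_right 1 this

theorem Model.le_of_dvd (hM : Model M S) {a b : M} (h : a ∣ b) (hb : 0 < b) : a ≤ b := by
  obtain ⟨k, rfl⟩ := h
  have : k ≠ 0 := by rintro rfl; simp at hb
  exact le_mul_of_one_le_right (zero_le) (hM.one_le k (pos_iff_ne_zero.2 this))

/-- Bounded `Δ⁰₀` sets are coded by numbers, through divisibility by the moduli. -/
theorem Model.exists_code (hM : Model M S) (N : M) : ∃ d : M, 0 < d ∧ ∀ R : M → Prop,
    (∀ {k : ℕ} (f : (Fin k → M) → M) [Poly f], Delta0 S (fun v => R (f v))) →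
    ∃ c, 0 < c ∧ ∀ z, z ≤ N → (BDvd (modulus d z) c ↔ R z) := by
  obtain ⟨d, hd, hdN⟩ := hM.exists_common_multiple 0 1 (by simp) N
  -- The terms 0 + (z + 1)·1 run through all positive numbers up to N + 1.
  have hdN : ∀ t, 0 < t → t ≤ N → t ∣ d := by
    intro t ht htN
    obtain ⟨s, rfl⟩ := exists_add_of_le (hM.one_le t ht)
    have := hM.bdvd_iff.1 (hdN s (le_trans (by simp) htN))
    simpa [add_comm] using this
  refine ⟨d, hd, fun R hR => ?_⟩
  -- The code is the product of the moduli of the elements below y. The guard on y keeps every index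
  -- within N, where Euclid's lemma for the moduli is available.
  have key : ∀ y, ∃ c, 0 < c ∧ (y ≤ N + 1 →
      ∀ z, z ≤ N → (BDvd (modulus d z) c ↔ z < y ∧ R z)) := by
    refine hM.ind1 _ inferInstance ?_ ?_
    · refine ⟨1, one_pos, fun _ z _ => ?_⟩
      rw [hM.bdvd_iff]
      simp only [not_lt_zero, false_and, iff_false]
      exact fun h => absurd (hM.le_of_dvd h one_pos) (not_le.2 (one_lt_modulus hd z))
    · rintro y ⟨c, hc, ih⟩
      by_cases hy : R y
      · refine ⟨c * modulus d y, mul_pos hc (one_pos.trans (one_lt_modulus hd y)),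
          fun hyN z hz => ?_⟩
        have hyN : y ≤ N := by simpa using hyN
        have ih := ih (hyN.trans (by simp)) z hz
        rw [hM.bdvd_iff] at ih ⊢
        rw [hM.lt_add_one_iff, le_iff_lt_or_eq]
        by_cases hzy : z = y
        · subst hzy; simp [hy]
        · simp only [hzy, or_false]
          rw [← ih]
          exact ⟨modulus_dvd_of_dvd_mul hdN hz hyN hzy, fun h => h.mul_right _⟩
      · refine ⟨c, hc, fun hyN z hz => ?_⟩
        have hyN : y ≤ N := by simpa using hyN
        rw [ih (hyN.trans (by simp)) z hz, hM.lt_add_one_iff, le_iff_lt_or_eq]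
        by_cases hzy : z = y
        · subst hzy; simp [hy]
        · simp [hzy]
  obtain ⟨c, hc, h⟩ := key (N + 1)
  refine ⟨c, hc, fun z hz => ?_⟩
  rw [h le_rfl z hz]
  simp [hM.lt_add_one_iff, hz]

/-- `Δ⁰₁`-comprehension for ternary relations. -/
theorem Model.comp_ternary (hM : Model M S) (R : M → M → M → Prop)
    (R₁ R₂ : M → M → M → M → M → Prop)
    (h₁ : ∀ {k : ℕ} (f g h i j : (Fin k → M) → M) [Poly f] [Poly g] [Poly h] [Poly i] [Poly j],
      Delta0 S (fun v => R₁ (f v) (g v) (h v) (i v) (j v)))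
    (h₂ : ∀ {k : ℕ} (f g h i j : (Fin k → M) → M) [Poly f] [Poly g] [Poly h] [Poly i] [Poly j],
      Delta0 S (fun v => R₂ (f v) (g v) (h v) (i v) (j v)))
    (hR₁ : ∀ p x q, R p x q ↔ ∃ c d, R₁ p x q c d)
    (hR₂ : ∀ p x q, ¬ R p x q ↔ ∃ c d, R₂ p x q c d) :
    ∃ X : S, ∀ p x q, pr p (pr x q) ∈ (X : Set M) ↔ R p x q := by
  -- The complement is Σ⁰₁ as well: components are bounded by the code of a triple, so not being
  -- such a code is Δ⁰₀.
  have hneg : ∀ z, ¬ (∃ p x q c d, z = pr p (pr x q) ∧ R₁ p x q c d) ↔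
      ∃ p x q c d, (z = pr p (pr x q) ∧ R₂ p x q c d) ∨
        ∀ p', p' ≤ z → ∀ x', x' ≤ z → ∀ q', q' ≤ z → ¬ z = pr p' (pr x' q') := by
    intro z
    constructor
    · intro hz
      by_cases hp : ∃ p x q, z = pr p (pr x q)
      · obtain ⟨p, x, q, hp⟩ := hp
        have : ¬ R p x q := by
          rw [hR₁]; rintro ⟨c, d, h⟩; exact hz ⟨p, x, q, c, d, hp, h⟩
        obtain ⟨c, d, h⟩ := (hR₂ p x q).1 this
        exact ⟨p, x, q, c, d, .inl ⟨hp, h⟩⟩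
      · exact ⟨0, 0, 0, 0, 0, .inr fun p' _ x' _ q' _ h => hp ⟨p', x', q', h⟩⟩
    · rintro ⟨p, x, q, c, d, h⟩ ⟨p', x', q', c', d', rfl, h'⟩
      rcases h with ⟨h0, h⟩ | h
      · rw [hM.pr_inj, hM.pr_inj] at h0
        obtain ⟨rfl, rfl, rfl⟩ := h0
        exact (hR₂ _ _ _).2 ⟨_, _, h⟩ ((hR₁ _ _ _).2 ⟨_, _, h'⟩)
      · exact h p' (left_le_pr _ _) x' ((left_le_pr _ _).trans (hM.right_le_pr _ _)) q'
          ((hM.right_le_pr _ _).trans (hM.right_le_pr _ _)) rfl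
  obtain ⟨X, hX⟩ := hM.comp (fun z => ∃ p x q c d, z = pr p (pr x q) ∧ R₁ p x q c d)
    inferInstance (by simp only [hneg]; infer_instance)
  refine ⟨X, fun p x q => ?_⟩
  rw [hX, hR₁]
  constructor
  · rintro ⟨p', x', q', c, d, h0, h⟩
    rw [hM.pr_inj, hM.pr_inj] at h0
    obtain ⟨rfl, rfl, rfl⟩ := h0
    exact ⟨c, d, h⟩
  · rintro ⟨c, d, h⟩
    exact ⟨p, x, q, c, d, rfl, h⟩

/-- Simultaneous recursion on `x` for the subsets `{q ≤ b | (p, x, q) ∈ X}`. -/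
theorem Model.exists_rec (hM : Model M S) (b : M) (Init : M → M → Prop)
    (Step : M → M → M → M → Prop)
    (hI : ∀ {k : ℕ} (f g : (Fin k → M) → M) [Poly f] [Poly g],
      Delta0 S (fun v => Init (f v) (g v)))
    (hS : ∀ {k : ℕ} (f g h i : (Fin k → M) → M) [Poly f] [Poly g] [Poly h] [Poly i],
      Delta0 S (fun v => Step (f v) (g v) (h v) (i v))) :
    ∃ X : S, (∀ p q, q ≤ b → (pr p (pr 0 q) ∈ (X : Set M) ↔ Init p q)) ∧
      ∀ p x q, q ≤ b → (pr p (pr (x + 1) q) ∈ (X : Set M) ↔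
        ∃ q', q' ≤ b ∧ (pr p (pr x q') ∈ (X : Set M) ∧ Step p x q' q)) := by
  -- The pair c, d codes the whole computation for p up to stage y. The redundant bound x ≤ y makes
  -- the quantifier syntactically bounded.
  let Good : M → M → M → M → Prop := fun p y c d =>
    (∀ q, q ≤ b → (BDvd (modulus d (pr 0 q)) c ↔ Init p q)) ∧
    ∀ x, x ≤ y → x + 1 ≤ y → ∀ q, q ≤ b → (BDvd (modulus d (pr (x + 1) q)) c ↔
      ∃ q', q' ≤ b ∧ (BDvd (modulus d (pr x q')) c ∧ Step p x q' q))
  have hGood : ∀ {k : ℕ} (f g h i : (Fin k → M) → M) [Poly f] [Poly g] [Poly h] [Poly i],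
      Delta0 S (fun v => Good (f v) (g v) (h v) (i v)) := by
    intros; simp only [Good]; infer_instance
  have hmono : ∀ p y y' c d, y ≤ y' → Good p y' c d → Good p y c d := by
    intro p y y' c d hy h
    exact ⟨h.1, fun x hx hx' => h.2 x (hx.trans hy) (hx'.trans hy)⟩
  have hex : ∀ p y, ∃ c d, Good p y c d := by
    intro p y
    obtain ⟨d, hd, hcode⟩ := hM.exists_code (pr y b)
    have key : ∀ x, ∃ c, x ≤ y → Good p x c d := by
      refine hM.ind1 _ inferInstance ?_ ?_
      · obtain ⟨c, -, hc⟩ := hcode (fun z => ∃ q, q ≤ b ∧ (z = pr 0 q ∧ Init p q))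
          (by intros; infer_instance)
        refine ⟨c, fun _ => ⟨fun q hq => ?_, fun x _ hx => ?_⟩⟩
        · rw [hc _ (pr_mono (zero_le) hq)]
          constructor
          · rintro ⟨q', -, h0, h⟩
            rw [hM.pr_inj] at h0
            rwa [h0.2]
          · exact fun h => ⟨q, hq, rfl, h⟩
        · simp at hx
      · rintro x ⟨c, ih⟩
        -- The next code, for the same d, keeps the rows up to x and adds row x + 1.
        obtain ⟨c', -, hc'⟩ := hcode
          (fun z => (∃ x', x' ≤ x ∧ ∃ q, q ≤ b ∧ (z = pr x' q ∧ BDvd (modulus d z) c)) ∨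
            ∃ q, q ≤ b ∧ (z = pr (x + 1) q ∧
              ∃ q', q' ≤ b ∧ (BDvd (modulus d (pr x q')) c ∧ Step p x q' q)))
          (by intros; infer_instance)
        refine ⟨c', fun hxy => ?_⟩
        have hxy' : x ≤ y := le_trans (by simp) hxy
        have ih := ih hxy'
        have hold : ∀ x', x' ≤ x → ∀ q, q ≤ b →
            (BDvd (modulus d (pr x' q)) c' ↔ BDvd (modulus d (pr x' q)) c) := by
          intro x' hx' q hq
          rw [hc' _ (pr_mono (hx'.trans hxy') hq)]
          constructor
          · rintro (⟨_, _, _, _, -, h⟩ | ⟨q₁, _, h0, -⟩)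
            · exact h
            · rw [hM.pr_inj] at h0
              rw [h0.1] at hx'
              exact absurd hx' (not_le.2 (lt_add_one x))
          · exact fun h => .inl ⟨x', hx', q, hq, rfl, h⟩
        have hnew : ∀ q, q ≤ b → (BDvd (modulus d (pr (x + 1) q)) c' ↔
            ∃ q', q' ≤ b ∧ (BDvd (modulus d (pr x q')) c ∧ Step p x q' q)) := by
          intro q hq
          rw [hc' _ (pr_mono hxy hq)]
          constructor
          · rintro (⟨x', hx', _, _, h0, -⟩ | ⟨q₁, _, h0, h⟩)
            · rw [hM.pr_inj] at h0
              rw [← h0.1] at hx'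
              exact absurd hx' (not_le.2 (lt_add_one x))
            · rw [hM.pr_inj] at h0
              rwa [h0.2]
          · exact fun h => .inr ⟨q, hq, rfl, h⟩
        refine ⟨fun q hq => ?_, fun x' _ hx' q hq => ?_⟩
        · rw [hold 0 (zero_le) q hq, ih.1 q hq]
        · have hx' : x' ≤ x := by simpa using hx'
          have hq' : ∀ q', (q' ≤ b ∧ (BDvd (modulus d (pr x' q')) c' ∧ Step p x' q' q)) ↔
              (q' ≤ b ∧ (BDvd (modulus d (pr x' q')) c ∧ Step p x' q' q)) := fun q' =>
            and_congr_right fun h => by rw [hold x' hx' q' h]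
          simp only [hq']
          rcases hx'.lt_or_eq with hlt | rfl
          · have hlt := hM.add_one_le_iff.2 hlt
            rw [hold _ hlt q hq]
            exact ih.2 x' hx' hlt q hq
          · exact hnew q hq
    obtain ⟨c, hc⟩ := key y
    exact ⟨c, d, hc le_rfl⟩
  have huniq : ∀ p y c d c' d', Good p y c d → Good p y c' d' → ∀ x, x ≤ y → ∀ q, q ≤ b →
      (BDvd (modulus d (pr x q)) c ↔ BDvd (modulus d' (pr x q)) c') := by
    intro p y c d c' d' h h'
    refine hM.ind1 _ inferInstance ?_ ?_
    · intro _ q hq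
      rw [h.1 q hq, h'.1 q hq]
    · intro x ih hx q hq
      have hx' : x ≤ y := le_trans (by simp) hx
      rw [h.2 x hx' hx q hq, h'.2 x hx' hx q hq]
      exact exists_congr fun q' => and_congr_right fun hq' => by rw [ih hx' q' hq']
  -- Since good codes exist and agree, membership and non-membership can both be read off from some
  -- good code.
  obtain ⟨X, hX⟩ := hM.comp_ternary
    (fun p x q => q ≤ b ∧ ∃ c d, Good p x c d ∧ BDvd (modulus d (pr x q)) c)
    (fun p x q c d => q ≤ b ∧ Good p x c d ∧ BDvd (modulus d (pr x q)) c)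
    (fun p x q c d => ¬ q ≤ b ∨ Good p x c d ∧ ¬ BDvd (modulus d (pr x q)) c)
    (by intros; infer_instance) (by intros; infer_instance)
    (by
      intro p x q
      constructor
      · rintro ⟨hq, c, d, h⟩; exact ⟨c, d, hq, h⟩
      · rintro ⟨c, d, hq, h⟩; exact ⟨hq, c, d, h⟩)
    (by
      intro p x q
      constructor
      · intro h
        obtain ⟨c, d, hg⟩ := hex p x
        refine ⟨c, d, ?_⟩
        by_cases hq : q ≤ b
        · exact .inr ⟨hg, fun h' => h ⟨hq, c, d, hg, h'⟩⟩
        · exact .inl hq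
      · rintro ⟨c, d, h⟩ ⟨hq, c', d', hg', h'⟩
        rcases h with h | ⟨hg, h⟩
        · exact h hq
        · exact h ((huniq p x c d c' d' hg hg' x le_rfl q hq).2 h'))
  have hX' : ∀ p y c d, Good p y c d → ∀ x, x ≤ y → ∀ q, q ≤ b →
      (pr p (pr x q) ∈ (X : Set M) ↔ BDvd (modulus d (pr x q)) c) := by
    intro p y c d hg x hx q hq
    have hg := hmono p x y c d hx hg
    rw [hX]
    constructor
    · rintro ⟨-, c', d', hg', h⟩
      exact (huniq p x c d c' d' hg hg' x le_rfl q hq).2 h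
    · exact fun h => ⟨hq, c, d, hg, h⟩
  refine ⟨X, fun p q hq => ?_, fun p x q hq => ?_⟩
  · obtain ⟨c, d, hg⟩ := hex p 0
    rw [hX' p 0 c d hg 0 le_rfl q hq, hg.1 q hq]
  · obtain ⟨c, d, hg⟩ := hex p (x + 1)
    have hx : x ≤ x + 1 := by simp
    rw [hX' p _ c d hg _ le_rfl q hq, hg.2 x hx le_rfl q hq]
    exact exists_congr fun q' => and_congr_right fun hq' => by rw [hX' p _ c d hg x hx q' hq']

end Coding

-- Reachability, extendible vertices and the infinite path.

section Konig

variable {M : Type u} [CommSemiring M] [LinearOrder M] [IsStrictOrderedRing M]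
  [CanonicallyOrderedAdd M] {S : Set (Set M)}

/-- `T j q n` says that some path of the level graph `A` of width `b` leads from `(q, j)` to
level `n`. -/
structure IsReach (b : M) (A T : M → M → M → Prop) : Prop where
  self : ∀ n q, q ≤ b → T n q n
  step : ∀ n j q, j < n → q ≤ b → (T j q n ↔ ∃ q', q' ≤ b ∧ (A j q q' ∧ T (j + 1) q' n))

/-- Levels go down while the recursion counts up, so it runs on the distance x = n - j, with the
target level n as the parameter. -/
theorem Model.exists_reach (hM : Model M S) (b : M) (A : M → M → M → Prop)
    (hA : ∀ {k : ℕ} (f g h : (Fin k → M) → M) [Poly f] [Poly g] [Poly h],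
      Delta0 S (fun v => A (f v) (g v) (h v))) :
    ∃ T : M → M → M → Prop, (∀ {k : ℕ} (f g h : (Fin k → M) → M) [Poly f] [Poly g] [Poly h],
      Delta0 S (fun v => T (f v) (g v) (h v))) ∧ IsReach b A T := by
  -- The equation 0 = 0 is a Δ⁰₀ form of truth: at distance 0 every vertex counts.
  obtain ⟨X, hX0, hX1⟩ := hM.exists_rec b (fun _ _ => (0 : M) = 0)
    (fun n x q' q => ∃ j, j ≤ n ∧ (x + (j + 1) = n ∧ A j q q'))
    (by intros; infer_instance) (by intros; infer_instance)
  refine ⟨fun j q n => ∃ x, x ≤ n ∧ (x + j = n ∧ pr n (pr x q) ∈ (X : Set M)),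
    by intros; infer_instance, fun n q hq => ?_, fun n j q hj hq => ?_⟩
  · exact ⟨0, zero_le, by simp, (hX0 n q hq).2 rfl⟩
  · obtain ⟨y, rfl⟩ := exists_add_of_le (hM.add_one_le_iff.2 hj)
    have h1 : ∀ x, x + j = j + 1 + y ↔ x = y + 1 := fun x => by
      rw [show j + 1 + y = (y + 1) + j by ring, add_left_inj]
    have h2 : ∀ x, x + (j + 1) = j + 1 + y ↔ x = y := fun x => by
      rw [add_comm (j + 1) y, add_left_inj]
    have h3 : ∀ j', y + (j' + 1) = j + 1 + y ↔ j' = j := fun x => by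
      rw [show j + 1 + y = y + (j + 1) by ring, add_right_inj, add_left_inj]
    have hy1 : y + 1 ≤ j + 1 + y := by rw [show j + 1 + y = y + 1 + j by ring]; simp
    have hy : y ≤ j + 1 + y := by simp
    constructor
    · rintro ⟨x, -, hx, h⟩
      rw [h1] at hx
      subst hx
      obtain ⟨q', hq', h, j', -, hj', ha⟩ := (hX1 _ _ _ hq).1 h
      rw [h3] at hj'
      subst hj'
      exact ⟨q', hq', ha, y, hy, (h2 y).2 rfl, h⟩
    · rintro ⟨q', hq', ha, x, -, hx, h⟩
      rw [h2] at hx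
      subst hx
      exact ⟨x + 1, hy1, (h1 _).2 rfl, (hX1 _ _ _ hq).2
        ⟨q', hq', h, j, hj.le, (h3 j).2 rfl, ha⟩⟩

section Reach

variable {b : M} {A T : M → M → M → Prop}

/-- Inclusion between the sets of vertices that reach two given levels propagates downward. -/
theorem Model.reach_mono_of_level (hM : Model M S)
    (hTd : ∀ {k : ℕ} (f g h : (Fin k → M) → M) [Poly f] [Poly g] [Poly h],
      Delta0 S (fun v => T (f v) (g v) (h v)))
    (hT : IsReach b A T) {l n n' : M} (hl : l ≤ n) (hl' : l ≤ n')
    (h : ∀ q, q ≤ b → T l q n → T l q n') :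
    ∀ j, j ≤ l → ∀ q, q ≤ b → T j q n → T j q n' := by
  refine hM.down_ind l _ (by intros; infer_instance) h ?_
  intro j hj ih q hq
  rw [hT.step n j q (hj.trans_le hl) hq, hT.step n' j q (hj.trans_le hl') hq]
  rintro ⟨q', hq', ha, ht⟩
  exact ⟨q', hq', ha, ih q' hq' ht⟩

/-- At level n itself every vertex reaches level n, so the inclusion needed there is trivial, and it
propagates downward. -/
theorem Model.reach_anti (hM : Model M S)
    (hTd : ∀ {k : ℕ} (f g h : (Fin k → M) → M) [Poly f] [Poly g] [Poly h],
      Delta0 S (fun v => T (f v) (g v) (h v)))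
    (hT : IsReach b A T) {j q n n' : M} (hj : j ≤ n) (hn : n ≤ n') (hq : q ≤ b)
    (h : T j q n') : T j q n :=
  hM.reach_mono_of_level hTd hT hn le_rfl (fun q hq _ => hT.self n q hq) j hj q hq h

theorem Model.exists_div (hM : Model M S) {y : M} (hy : 0 < y) (a : M) :
    ∃ u v, a = y * u + v ∧ v < y := by
  revert a
  refine hM.ind1 _ inferInstance ?_ ?_
  · exact ⟨0, 0, by simp, hy⟩
  · rintro _ ⟨u, v, rfl, hv⟩
    rcases (hM.add_one_le_iff.2 hv).lt_or_eq with h | h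
    · exact ⟨u, v + 1, by ring, h⟩
    · exact ⟨u + 1, 0, by rw [add_assoc, h]; ring, hy⟩

/-- If `m` is the least common multiple of the moduli of a coded set, then `m` codes that set. -/
theorem Model.dvd_iff_of_least (hM : Model M S) {d m : M} (hm : 0 < m) (R : M → Prop)
    (hcode : ∃ c, 0 < c ∧ ∀ r, r ≤ b → (BDvd (modulus d r) c ↔ R r))
    (hR : ∀ r, r ≤ b → R r → BDvd (modulus d r) m)
    (hmin : ∀ y, 0 < y → y < m → ∃ r, r ≤ b ∧ (R r ∧ ¬ BDvd (modulus d r) y)) :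
    ∀ r, r ≤ b → (R r ↔ BDvd (modulus d r) m) := by
  obtain ⟨c, hc, hcR⟩ := hcode
  obtain ⟨u, v, rfl, hv⟩ := hM.exists_div hm c
  -- The remainder of c modulo m is a common multiple below m, so it vanishes. Then m divides c, and
  -- c has no moduli as divisors other than those of the set.
  have hv0 : v = 0 := by
    by_contra hv0
    obtain ⟨r, hr, hRr, hnd⟩ := hmin v (pos_iff_ne_zero.2 hv0) hv
    refine hnd (hM.bdvd_iff.2 (dvd_of_dvd_add (hM.bdvd_iff.1 ((hcR r hr).2 hRr)) ?_))
    exact (hM.bdvd_iff.1 (hR r hr hRr)).mul_right u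
  subst hv0
  intro r hr
  refine ⟨hR r hr, fun h => (hcR r hr).1 ?_⟩
  rw [hM.bdvd_iff] at h ⊢
  simpa using h.mul_right u

/-- By `Σ⁰₂` induction, there are a number `m` and a level from which on the set of vertices that
reach level `n` never has a common multiple below `m`, while `m` itself is one infinitely often. -/
theorem Model.exists_least_multiple (hM : Model M S)
    (hTd : ∀ {k : ℕ} (f g h : (Fin k → M) → M) [Poly f] [Poly g] [Poly h],
      Delta0 S (fun v => T (f v) (g v) (h v))) (d : M) :
    ∃ m l, 0 < m ∧
      (∀ i n, l ≤ i → i ≤ n → ∀ y, 0 < y → y < m →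
        ∃ r, r ≤ b ∧ (T i r n ∧ ¬ BDvd (modulus d r) y)) ∧
      ∀ j, ∃ i n, j ≤ i ∧ l ≤ i ∧ i ≤ n ∧ ∀ r, r ≤ b → T i r n → BDvd (modulus d r) m := by
  -- The bound y ≤ m is redundant, but it makes the matrix Δ⁰₀, so that φ is Σ⁰₂.
  let φ : M → Prop := fun m => ∃ l, ∀ i n, l ≤ i → i ≤ n → ∀ y, y ≤ m → 0 < y → y < m →
    ∃ r, r ≤ b ∧ (T i r n ∧ ¬ BDvd (modulus d r) y)
  have hφ : ∃ m, φ m ∧ ¬ φ (m + 1) := by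
    by_contra! hcon
    have hall : ∀ m, φ m := hM.ind2 φ (by simp only [φ]; infer_instance)
      ⟨0, fun i n _ _ y _ _ h => absurd h (by simp)⟩ hcon
    -- A common multiple B of all moduli up to b refutes φ(B + 1).
    obtain ⟨B, hB, hBd⟩ := hM.exists_common_multiple 1 d (by positivity) b
    obtain ⟨l, hl⟩ := hall (B + 1)
    obtain ⟨r, hr, -, h⟩ := hl l l le_rfl le_rfl B (by simp) hB (lt_add_one B)
    exact h (hBd r hr)
  obtain ⟨m, ⟨l, hl⟩, hm⟩ := hφ
  have hm0 : 0 < m := by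
    rw [pos_iff_ne_zero]
    rintro rfl
    refine hm ⟨0, fun i n _ _ y _ hy hy' => ?_⟩
    rw [hM.lt_add_one_iff] at hy'
    exact absurd hy (not_lt.2 hy')
  refine ⟨m, l, hm0, fun i n hi hn y hy hym => hl i n hi hn y hym.le hy hym, fun j => ?_⟩
  simp only [φ, not_exists] at hm
  -- Failure of φ(m + 1) beyond both j and l gives a common multiple y ≤ m; the choice of l excludes
  -- y < m.
  have hj := hm (max j l)
  push Not at hj
  obtain ⟨i, n, hi, hn, y, -, hy, hym, hr⟩ := hj
  have hli := (le_max_right j l).trans hi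
  have hmy : y = m := by
    refine le_antisymm (hM.lt_add_one_iff.1 hym) (not_lt.1 fun hlt => ?_)
    obtain ⟨r, hrb, ht, hnd⟩ := hl i n hli hn y hlt.le hy hlt
    exact hnd (hr r hrb ht)
  subst hmy
  exact ⟨i, n, (le_max_left j l).trans hi, hli, hn, hr⟩

/-- In a level graph of bounded width, having arbitrarily long paths is decidable, and passes to
some successor. -/
theorem Model.exists_extendible (hM : Model M S)
    (hTd : ∀ {k : ℕ} (f g h : (Fin k → M) → M) [Poly f] [Poly g] [Poly h],
      Delta0 S (fun v => T (f v) (g v) (h v)))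
    (hT : IsReach b A T) :
    ∃ J : M → M → Prop, (∀ {k : ℕ} (f g : (Fin k → M) → M) [Poly f] [Poly g],
      Delta0 S (fun v => J (f v) (g v))) ∧
      (∀ i q, q ≤ b → (∀ n, i ≤ n → T i q n) → J i q) ∧
      ∀ i q, q ≤ b → J i q → ∃ q', q' ≤ b ∧ A i q q' ∧ J (i + 1) q' := by
  obtain ⟨d, hd, hcode⟩ := hM.exists_code b
  obtain ⟨m, l, hm0, hmin, hinf⟩ := hM.exists_least_multiple (b := b) hTd d
  -- Such i, n certify that the vertices of level j reaching level n are already the extendible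
  -- ones.
  let Cov : M → M → M → Prop := fun j i n =>
    j ≤ i ∧ l ≤ i ∧ i ≤ n ∧ ∀ r, r ≤ b → T i r n → BDvd (modulus d r) m
  have hCovd : ∀ {k : ℕ} (f g h : (Fin k → M) → M) [Poly f] [Poly g] [Poly h],
      Delta0 S (fun v => Cov (f v) (g v) (h v)) := by
    intros; simp only [Cov]; infer_instance
  have hCov : ∀ {j i n q}, Cov j i n → q ≤ b → T j q n → ∀ n', j ≤ n' → T j q n' := by
    rintro j i n q ⟨hj, hl, hn, hc⟩ hq ht n' hn'
    rcases le_total n' n with h | h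
    · exact hM.reach_anti hTd hT hn' h hq ht
    · refine hM.reach_mono_of_level hTd hT hn (hn.trans h) ?_ j hj q hq ht
      have hc' : ∀ r, r ≤ b → T i r n' → BDvd (modulus d r) m := fun r hr ht' =>
        hc r hr (hM.reach_anti hTd hT hn h hr ht')
      -- The same m decodes to the sets for n and for n', so these coincide.
      have e := hM.dvd_iff_of_least hm0 _ (hcode (fun r => T i r n) (by intros; infer_instance))
        hc (hmin i n hl hn)
      have e' := hM.dvd_iff_of_least hm0 _
        (hcode (fun r => T i r n') (by intros; infer_instance)) hc' (hmin i n' hl (hn.trans h))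
      exact fun r hr h => (e' r hr).2 ((e r hr).1 h)
  obtain ⟨X, hX⟩ := hM.comp_ternary (fun _ j q => q ≤ b ∧ ∀ n, j ≤ n → T j q n)
    (fun _ j q i n => q ≤ b ∧ Cov j i n ∧ T j q n)
    (fun _ j q n _ => ¬ q ≤ b ∨ j ≤ n ∧ ¬ T j q n)
    (by intros; infer_instance) (by intros; infer_instance)
    (by
      intro _ j q
      constructor
      · rintro ⟨hq, h⟩
        obtain ⟨i, n, hc⟩ := hinf j
        exact ⟨i, n, hq, hc, h n (hc.1.trans hc.2.2.1)⟩
      · rintro ⟨i, n, hq, hc, ht⟩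
        exact ⟨hq, hCov hc hq ht⟩)
    (by
      intro _ j q
      constructor
      · intro h
        by_cases hq : q ≤ b
        · have : ∃ n, j ≤ n ∧ ¬ T j q n := by
            by_contra! h'
            exact h ⟨hq, h'⟩
          obtain ⟨n, hn⟩ := this
          exact ⟨n, 0, .inr hn⟩
        · exact ⟨0, 0, .inl hq⟩
      · rintro ⟨n, -, h⟩ ⟨hq, h'⟩
        rcases h with h | h
        · exact h hq
        · exact h.2 (h' n h.1))
  refine ⟨fun j q => pr 0 (pr j q) ∈ (X : Set M), by intros; infer_instance,
    fun i q hq h => (hX _ _ _).2 ⟨hq, h⟩, fun j q hq h => ?_⟩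
  obtain ⟨-, h⟩ := (hX _ _ _).1 h
  -- A certificate for level j + 1: a successor that reaches this single n is extendible.
  obtain ⟨i, n, hc⟩ := hinf (j + 1)
  have hjn : j < n := hM.add_one_le_iff.1 (hc.1.trans hc.2.2.1)
  obtain ⟨q', hq', ha, ht⟩ := (hT.step n j q hjn hq).1 (h n hjn.le)
  exact ⟨q', hq', ha, (hX _ _ _).2 ⟨hq', hCov hc hq' ht⟩⟩

end Reach

/-- Without a least element, Σ⁰₁ induction shows that no y ≤ x satisfies P. The redundant bound in
the conclusion matches the Δ⁰₀ step relation in `Model.exists_path`. -/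
theorem Model.exists_least (hM : Model M S) (P : M → Prop)
    (hP : ∀ {k : ℕ} (f : (Fin k → M) → M) [Poly f], Delta0 S (fun v => P (f v)))
    {a : M} (ha : P a) : ∃ x, P x ∧ ∀ y, y ≤ x → y < x → ¬ P y := by
  by_contra! hcon
  have key : ∀ x, ∀ y, y ≤ x → ¬ P y := by
    refine hM.ind1 _ inferInstance ?_ ?_
    · intro y hy hPy
      obtain ⟨z, -, hz, -⟩ := hcon y hPy
      rw [nonpos_iff_eq_zero.1 hy] at hz
      simp at hz
    · intro x ih y hy hPy
      obtain ⟨z, -, hz, hPz⟩ := hcon y hPy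
      exact ih z (hM.lt_add_one_iff.1 (hz.trans_le hy)) hPz
  exact key a a le_rfl ha

/-- A decidable property of vertices that passes to some successor yields an infinite path. -/
theorem Model.exists_path (hM : Model M S) {b q₀ : M} {A : M → M → M → Prop} {J : M → M → Prop}
    (hA : ∀ {k : ℕ} (f g h : (Fin k → M) → M) [Poly f] [Poly g] [Poly h],
      Delta0 S (fun v => A (f v) (g v) (h v)))
    (hJd : ∀ {k : ℕ} (f g : (Fin k → M) → M) [Poly f] [Poly g],
      Delta0 S (fun v => J (f v) (g v)))
    (hJ : ∀ i q, q ≤ b → J i q → ∃ q', q' ≤ b ∧ A i q q' ∧ J (i + 1) q')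
    (hq₀ : q₀ ≤ b) (hJ₀ : J 0 q₀) :
    ∃ X : S, ∃ f : M → M, f 0 = q₀ ∧ (∀ i, A i (f i) (f (i + 1))) ∧
      ∀ z, z ∈ (X : Set M) ↔ ∃ i, z = pr i (pr (f i) i) := by
  -- The recursion produces sets; taking the least good successor keeps each of them a singleton.
  obtain ⟨U, hU0, hU1⟩ := hM.exists_rec b (fun _ q => q = q₀)
    (fun _ x q' q => (A x q' q ∧ J (x + 1) q) ∧
      ∀ r, r ≤ q → r < q → ¬ (A x q' r ∧ J (x + 1) r))
    (by intros; infer_instance) (by intros; infer_instance)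
  have hex : ∀ x, ∃ q, q ≤ b ∧ pr 0 (pr x q) ∈ (U : Set M) ∧ J x q := by
    refine hM.ind1 _ inferInstance ?_ ?_
    · exact ⟨q₀, hq₀, (hU0 _ _ hq₀).2 rfl, hJ₀⟩
    · rintro x ⟨q, hq, hu, hj⟩
      obtain ⟨q', hq', ha, hj'⟩ := hJ x q hq hj
      obtain ⟨r, hr, hmin⟩ := hM.exists_least (fun r => A x q r ∧ J (x + 1) r)
        (by intros; infer_instance) ⟨ha, hj'⟩
      have hrb : r ≤ b := by
        refine le_trans (not_lt.1 fun h => ?_) hq'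
        exact hmin q' h.le h ⟨ha, hj'⟩
      exact ⟨r, hrb, (hU1 _ _ _ hrb).2 ⟨q, hq, hu, hr, hmin⟩, hr.2⟩
  have huniq : ∀ x, ∀ q, q ≤ b → ∀ q', q' ≤ b → pr 0 (pr x q) ∈ (U : Set M) →
      pr 0 (pr x q') ∈ (U : Set M) → q = q' := by
    refine hM.ind1 _ inferInstance ?_ ?_
    · intro q hq q' hq' h h'
      rw [(hU0 _ _ hq).1 h, (hU0 _ _ hq').1 h']
    · intro x ih q hq q' hq' h h'
      obtain ⟨r, hr, hu, hs, hmin⟩ := (hU1 _ _ _ hq).1 h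
      obtain ⟨r', hr', hu', hs', hmin'⟩ := (hU1 _ _ _ hq').1 h'
      obtain rfl := ih r hr r' hr' hu hu'
      rcases lt_trichotomy q q' with hlt | heq | hlt
      · exact absurd hs (hmin' q hlt.le hlt)
      · exact heq
      · exact absurd hs' (hmin q' hlt.le hlt)
  -- The function f is chosen in the metatheory, but by uniqueness its graph is read off from U.
  choose f hfb hfU _ using hex
  have hf : ∀ x q, q ≤ b → pr 0 (pr x q) ∈ (U : Set M) → q = f x := fun x q hq h =>
    huniq x q hq _ (hfb x) h (hfU x)
  obtain ⟨X, hX⟩ := hM.comp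
    (fun z => ∃ i, i ≤ z ∧ ∃ q, q ≤ b ∧ (z = pr i (pr q i) ∧ pr 0 (pr i q) ∈ (U : Set M)))
    inferInstance inferInstance
  refine ⟨X, f, (hf 0 q₀ hq₀ ((hU0 _ _ hq₀).2 rfl)).symm, fun i => ?_, fun z => ?_⟩
  · obtain ⟨q, hq, hu, hs, -⟩ := (hU1 _ _ _ (hfb (i + 1))).1 (hfU (i + 1))
    rw [← hf i q hq hu]
    exact hs.1
  · rw [hX]
    constructor
    · rintro ⟨i, -, q, hq, rfl, hu⟩
      exact ⟨i, by rw [hf i q hq hu]⟩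
    · rintro ⟨i, rfl⟩
      exact ⟨i, left_le_pr _ _, f i, hfb i, rfl, hfU i⟩

/-- `v` is the `i`-th entry of the sequence with β-code `c, d`. -/
def Entry (c d i v : M) : Prop := v < 1 + (i + 1) * d ∧ ∃ k, c = k * (1 + (i + 1) * d) + v

/-- Remainders below the modulus force equal quotients, after which addition cancels. -/
theorem Model.entry_unique (hM : Model M S) {c d i v w : M} (hv : Entry c d i v)
    (hw : Entry c d i w) : v = w := by
  have aux : ∀ {y k k' v w : M}, v < y → w < y → k * y + v = k' * y + w → k ≤ k' := by
    intro y k k' v w hv _ h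
    by_contra! hlt
    have h1 : k' * y + w < k' * y + y := by gcongr
    have h2 : k' * y + y ≤ k * y := by
      rw [← add_one_mul]; gcongr; exact hM.add_one_le_iff.2 hlt
    have h3 : k * y ≤ k * y + v := by simp
    exact absurd h (h1.trans_le (h2.trans h3)).ne'
  obtain ⟨hv, k, hk⟩ := hv
  obtain ⟨hw, k', hk'⟩ := hw
  have e : k * (1 + (i + 1) * d) + v = k' * (1 + (i + 1) * d) + w := hk.symm.trans hk'
  obtain rfl : k = k' := le_antisymm (aux hv hw e) (aux hw hv e.symm)
  exact add_left_cancel e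

/-- The modulus is at least 1, so the quotient is bounded by c and the relation is Δ⁰₀. -/
theorem entry_iff {c d i v : M} : Entry c d i v ↔
    v < 1 + (i + 1) * d ∧ ∃ k, k ≤ c ∧ c = k * (1 + (i + 1) * d) + v := by
  refine and_congr_right fun _ => exists_congr fun k => ⟨fun h => ⟨?_, h⟩, fun h => h.2⟩
  calc k ≤ k * (1 + (i + 1) * d) := le_mul_of_one_le_right zero_le (by simp)
    _ ≤ c := by rw [h]; simp

theorem entry_delta0 {k : ℕ} (f g h i : (Fin k → M) → M) [Poly f] [Poly g] [Poly h] [Poly i] : Delta0 S (fun v => Entry (f v) (g v) (h v) (i v)) := by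
  simp only [entry_iff]; infer_instance

/-- Bounded-width König's Lemma in semantic form. -/
theorem Model.konig (hM : Model M S) (Q V E : S) {b : M} (hQ : ∀ x, x ∈ (Q : Set M) → x ≤ b)
    (hV : ∀ z, z ∈ (V : Set M) → ∃ a i, a ∈ (Q : Set M) ∧ z = pr a i)
    (hE : ∀ z, z ∈ (E : Set M) → ∃ a a' i, pr a i ∈ (V : Set M) ∧
      pr a' (i + 1) ∈ (V : Set M) ∧ z = pr (pr a i) (pr a' (i + 1)))
    (q₀ : M) (hlong : ∀ n, ∃ m c d, n ≤ m ∧ pr q₀ 0 ∈ (V : Set M) ∧ Entry c d 0 (pr q₀ 0) ∧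
      ∀ j, j < m → ∃ v w, Entry c d j v ∧ Entry c d (j + 1) w ∧ pr v w ∈ (E : Set M)) :
    ∃ P : S, ((∀ z, z ∈ (P : Set M) → ∃ x y, z = pr x y) ∧
      (∀ x, ∃ y, pr x y ∈ (P : Set M)) ∧
      ∀ x y z, pr x y ∈ (P : Set M) ∧ pr x z ∈ (P : Set M) → y = z) ∧
      pr 0 (pr q₀ 0) ∈ (P : Set M) ∧
      ∀ x y z, pr x y ∈ (P : Set M) ∧ pr (x + 1) z ∈ (P : Set M) → pr y z ∈ (E : Set M) := by
  have hVb : ∀ a i, pr a i ∈ (V : Set M) → a ≤ b := by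
    intro a i h
    obtain ⟨a', i', ha, h0⟩ := hV _ h
    rw [hM.pr_inj] at h0
    rw [h0.1]; exact hQ _ ha
  have hEd : ∀ v w, pr v w ∈ (E : Set M) → ∃ a a' i, a ≤ b ∧ a' ≤ b ∧ v = pr a i ∧
      w = pr a' (i + 1) := by
    intro v w h
    obtain ⟨a, a', i, ha, ha', h0⟩ := hE _ h
    rw [hM.pr_inj] at h0
    exact ⟨a, a', i, hVb _ _ ha, hVb _ _ ha', h0.1, h0.2⟩
  let A : M → M → M → Prop := fun j q q' => pr (pr q j) (pr q' (j + 1)) ∈ (E : Set M)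
  have hA : ∀ {k : ℕ} (f g h : (Fin k → M) → M) [Poly f] [Poly g] [Poly h],
      Delta0 S (fun v => A (f v) (g v) (h v)) := by
    intros; simp only [A]; infer_instance
  obtain ⟨T, hTd, hT⟩ := hM.exists_reach b A hA
  obtain ⟨J, hJd, hJ0, hJ⟩ := hM.exists_extendible hTd hT
  have hq₀ : q₀ ≤ b := by
    obtain ⟨_, _, _, -, h, -⟩ := hlong 0
    exact hVb _ _ h
  have hT₀ : ∀ n, T 0 q₀ n := by
    intro n
    obtain ⟨m, c, d, hnm, -, h0, hpath⟩ := hlong n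
    have hent : ∀ {k : ℕ} (f g h i : (Fin k → M) → M) [Poly f] [Poly g] [Poly h] [Poly i],
        Delta0 S (fun v => Entry (f v) (g v) (h v) (i v)) := entry_delta0
    -- The j-th entry is a vertex of level j, because edges raise the level by one.
    have hfwd : ∀ j, j ≤ m → ∃ q, q ≤ b ∧ Entry c d j (pr q j) := by
      refine hM.ind1 _ inferInstance ?_ ?_
      · exact fun _ => ⟨q₀, hq₀, h0⟩
      · intro j ih hj
        have hjm := hM.add_one_le_iff.1 hj
        obtain ⟨q, hq, he⟩ := ih hjm.le
        obtain ⟨v, w, hv, hw, hvw⟩ := hpath j hjm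
        obtain ⟨a, a', i, _, ha', rfl, rfl⟩ := hEd v w hvw
        have := hM.entry_unique hv he
        rw [hM.pr_inj] at this
        rw [this.2] at hw
        exact ⟨a', ha', hw⟩
    -- Cut the path at level n ≤ m and follow it backward, accumulating reachability of n.
    have hback : ∀ j, j ≤ n → ∃ q, q ≤ b ∧ (Entry c d j (pr q j) ∧ T j q n) := by
      refine hM.down_ind n _ (by intros; infer_instance) ?_ ?_
      · obtain ⟨q, hq, he⟩ := hfwd n hnm
        exact ⟨q, hq, he, hT.self n q hq⟩
      · rintro j hj ⟨q, hq, he, ht⟩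
        obtain ⟨v, w, hv, hw, hvw⟩ := hpath j (hj.trans_le hnm)
        obtain ⟨a, a', i, ha, _, rfl, rfl⟩ := hEd v w hvw
        have := hM.entry_unique hw he
        rw [hM.pr_inj, add_left_inj] at this
        obtain ⟨rfl, rfl⟩ := this
        exact ⟨a, ha, hv, (hT.step n i a hj ha).2 ⟨a', hq, hvw, ht⟩⟩
    obtain ⟨q, hq, he, ht⟩ := hback 0 zero_le
    have := hM.entry_unique he h0
    rw [hM.pr_inj] at this
    rwa [this.1] at ht
  obtain ⟨P, f, hf0, hfA, hP⟩ :=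
    hM.exists_path hA hJd hJ hq₀ (hJ0 0 q₀ hq₀ fun n _ => hT₀ n)
  have hP' : ∀ x y, pr x y ∈ (P : Set M) ↔ y = pr (f x) x := by
    intro x y
    rw [hP]
    constructor
    · rintro ⟨i, h⟩
      rw [hM.pr_inj] at h
      obtain ⟨rfl, h⟩ := h
      exact h
    · rintro rfl; exact ⟨x, rfl⟩
  refine ⟨P, ⟨fun z hz => ?_, fun x => ⟨_, (hP' _ _).2 rfl⟩, fun x y z h => ?_⟩, ?_,
    fun x y z h => ?_⟩
  · obtain ⟨i, h⟩ := (hP z).1 hz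
    exact ⟨_, _, h⟩
  · rw [hP', hP'] at h
    rw [h.1, h.2]
  · rw [hP', hf0]
  · rw [hP', hP'] at h
    rw [h.1, h.2]
    exact hfA x

end Konig

/-! ### Formulas representing the semantic classes -/

@[simp] theorem L2Structure.eval_zero (M : L2Structure.{u}) (e : ℕ → M.carrier) :
    M.eval e 0 = M.zero := rfl

@[simp] theorem L2Structure.eval_one (M : L2Structure.{u}) (e : ℕ → M.carrier) :
    M.eval e 1 = M.one := rfl

@[simp] theorem L2Structure.eval_add (M : L2Structure.{u}) (e : ℕ → M.carrier) (s t : Term) :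
    M.eval e (s + t) = M.add (M.eval e s) (M.eval e t) := rfl

theorem L2Structure.realize_update_set (M : L2Structure.{u}) {X : ℕ} (A : M.sets) :
    ∀ (φ : Formula) (e : ℕ → M.carrier) (E : ℕ → M.sets), X ∉ φ.setVars →
      (M.Realize φ e (Function.update E X A) ↔ M.Realize φ e E)
  | .eq _ _, _, _, _ => Iff.rfl
  | .le _ _, _, _, _ => Iff.rfl
  | .mem t Y, e, E, h => by
    have : Y ≠ X := fun h' => h (by simp [Formula.setVars, h'])
    simp [L2Structure.Realize, this]
  | .neg φ, e, E, h => not_congr (M.realize_update_set A φ e E h)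
  | .and φ ψ, e, E, h => by
    simp only [Formula.setVars, Finset.mem_union, not_or] at h
    exact and_congr (M.realize_update_set A φ e E h.1) (M.realize_update_set A ψ e E h.2)
  | .or φ ψ, e, E, h => by
    simp only [Formula.setVars, Finset.mem_union, not_or] at h
    exact or_congr (M.realize_update_set A φ e E h.1) (M.realize_update_set A ψ e E h.2)
  | .imp φ ψ, e, E, h => by
    simp only [Formula.setVars, Finset.mem_union, not_or] at h
    exact imp_congr (M.realize_update_set A φ e E h.1) (M.realize_update_set A ψ e E h.2)
  | .all x φ, e, E, h => forall_congr' fun a => M.realize_update_set A φ _ E h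
  | .ex x φ, e, E, h => exists_congr fun a => M.realize_update_set A φ _ E h
  | .allS Y φ, e, E, h => by
    simp only [Formula.setVars, Finset.mem_insert, not_or] at h
    refine forall_congr' fun B => ?_
    rw [Function.update_comm h.1]
    exact M.realize_update_set A φ e _ h.2
  | .exS Y φ, e, E, h => by
    simp only [Formula.setVars, Finset.mem_insert, not_or] at h
    refine exists_congr fun B => ?_
    rw [Function.update_comm h.1]
    exact M.realize_update_set A φ e _ h.2

/-- The assignment `e` gives the odd variables the values listed by `κ`. -/
def ReadsParams {α : Type u} (κ e : ℕ → α) : Prop := ∀ k, e (2 * k + 1) = κ k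

theorem ReadsParams.update {α : Type u} {κ e : ℕ → α} (h : ReadsParams κ e) (n : ℕ) (a : α) :
    ReadsParams κ (Function.update e (2 * n) a) := fun k => by
  rw [Function.update_of_ne (by omega), h k]

theorem update_even_castSucc {α : Type u} (e : ℕ → α) (n : ℕ) (a : α) (i : Fin n) :
    Function.update e (2 * n) a (2 * (i.castSucc : ℕ)) = e (2 * (i : ℕ)) := by
  rw [Function.update_of_ne (by simpa using i.2.ne)]; rfl

/-- The function `f` is given by a term whose even variables are the arguments of `f` and whose
odd variables are parameters. -/
def RepresentsTerm (M : L2Structure.{u}) {n : ℕ} (f : (Fin n → M.carrier) → M.carrier) : Prop :=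
  ∃ cs : List M.carrier, ∀ κ : ℕ → M.carrier, (∀ c ∈ cs, ∃ k, κ k = c) →
    ∃ t : Term, 2 * n ∉ t.vars ∧ ∀ e, ReadsParams κ e → M.eval e t = f (fun i => e (2 * i))

/-- The relation `P` is given by a formula of class `C` whose free even variables are the arguments
of `P` and whose free odd variables and set variables are parameters. -/
def Represents (M : L2Structure.{u}) (C : Formula → Prop) {n : ℕ}
    (P : (Fin n → M.carrier) → Prop) : Prop :=
  ∃ (cs : List M.carrier) (Xs : List M.sets), ∀ (κ : ℕ → M.carrier) (E : ℕ → M.sets),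
    (∀ c ∈ cs, ∃ k, κ k = c) → (∀ X ∈ Xs, ∃ k, E k = X) →
    ∃ φ : Formula, C φ ∧ ∀ e, ReadsParams κ e → (M.Realize φ e E ↔ P (fun i => e (2 * i)))

section Represents

variable {M : L2Structure.{u}}

theorem Represents.mono {C C' : Formula → Prop} (hC : ∀ φ, C φ → C' φ) {n : ℕ}
    {P : (Fin n → M.carrier) → Prop} (h : Represents M C P) : Represents M C' P := by
  obtain ⟨cs, Xs, h⟩ := h
  refine ⟨cs, Xs, fun κ E hκ hE => ?_⟩
  obtain ⟨φ, hφ, h⟩ := h κ E hκ hE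
  exact ⟨φ, hC φ hφ, h⟩

/-- Here F is the syntax and G its meaning. Parameter lists can be concatenated because
representation holds for every κ that lists the required values. -/
theorem Represents.ofTerms {C : Formula → Prop} (F : Term → Term → Formula)
    (G : M.carrier → M.carrier → Prop) (hC : ∀ s t, C (F s t))
    (hF : ∀ s t e E, M.Realize (F s t) e E ↔ G (M.eval e s) (M.eval e t)) {n : ℕ}
    {f g : (Fin n → M.carrier) → M.carrier} (hf : RepresentsTerm M f) (hg : RepresentsTerm M g) :
    Represents M C (fun v => G (f v) (g v)) := by
  obtain ⟨cs, hf⟩ := hf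
  obtain ⟨cs', hg⟩ := hg
  refine ⟨cs ++ cs', [], fun κ E hκ hE => ?_⟩
  obtain ⟨s, -, hs⟩ := hf κ fun c hc => hκ c (by simp [hc])
  obtain ⟨t, -, ht⟩ := hg κ fun c hc => hκ c (by simp [hc])
  exact ⟨F s t, hC s t, fun e he => by rw [hF, hs e he, ht e he]⟩

theorem Represents.connective {C : Formula → Prop} (F : Formula → Formula → Formula)
    (G : Prop → Prop → Prop) (hC : ∀ φ ψ, C φ → C ψ → C (F φ ψ))
    (hF : ∀ φ ψ e E, M.Realize (F φ ψ) e E ↔ G (M.Realize φ e E) (M.Realize ψ e E)) {n : ℕ}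
    {P Q : (Fin n → M.carrier) → Prop} (hP : Represents M C P) (hQ : Represents M C Q) :
    Represents M C (fun v => G (P v) (Q v)) := by
  obtain ⟨cs, Xs, hP⟩ := hP
  obtain ⟨cs', Xs', hQ⟩ := hQ
  refine ⟨cs ++ cs', Xs ++ Xs', fun κ E hκ hE => ?_⟩
  obtain ⟨φ, hφ, hφ'⟩ := hP κ E (fun c hc => hκ c (by simp [hc])) fun X hX => hE X (by simp [hX])
  obtain ⟨ψ, hψ, hψ'⟩ := hQ κ E (fun c hc => hκ c (by simp [hc])) fun X hX => hE X (by simp [hX])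
  exact ⟨F φ ψ, hC φ ψ hφ hψ, fun e he => by rw [hF, hφ' e he, hψ' e he]⟩

/-- The bound variable is 2n, the next argument slot; `RepresentsTerm` keeps it out of the bounding
term, as `IsDelta0` demands. -/
theorem Represents.bounded {C : Formula → Prop} (F : ℕ → Term → Formula → Formula)
    (G : M.carrier → (M.carrier → Prop) → Prop)
    (hC : ∀ x t φ, x ∉ t.vars → C φ → C (F x t φ))
    (hF : ∀ x t φ e E (b : M.carrier), (∀ a, M.eval (Function.update e x a) t = b) →
      (M.Realize (F x t φ) e E ↔ G b fun a => M.Realize φ (Function.update e x a) E)) {n : ℕ}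
    {f : (Fin n → M.carrier) → M.carrier} {P : (Fin n → M.carrier) → M.carrier → Prop}
    (hf : RepresentsTerm M f)
    (hP : Represents M C (fun w : Fin (n + 1) → M.carrier =>
      P (fun i => w i.castSucc) (w (Fin.last n)))) :
    Represents M C (fun v => G (f v) (P v)) := by
  obtain ⟨cs, hf⟩ := hf
  obtain ⟨cs', Xs, hP⟩ := hP
  refine ⟨cs ++ cs', Xs, fun κ E hκ hE => ?_⟩
  obtain ⟨t, htv, ht⟩ := hf κ fun c hc => hκ c (by simp [hc])
  obtain ⟨φ, hφ, hφ'⟩ := hP κ E (fun c hc => hκ c (by simp [hc])) hE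
  refine ⟨F (2 * n) t φ, hC _ _ _ htv hφ, fun e he => ?_⟩
  rw [hF (2 * n) t φ e E (f fun i => e (2 * i))]
  · simp only [hφ' _ (he.update n _), update_even_castSucc, Fin.val_last, Function.update_self]
  · intro a
    rw [ht _ (he.update n a)]
    congr 1
    funext i
    exact update_even_castSucc e n a i

theorem Represents.quantifier {C : Formula → Prop} (F : ℕ → Formula → Formula)
    (G : (M.carrier → Prop) → Prop) (hC : ∀ x φ, C φ → C (F x φ))
    (hF : ∀ x φ e E, M.Realize (F x φ) e E ↔ G fun a => M.Realize φ (Function.update e x a) E)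
    {n : ℕ} {P : (Fin n → M.carrier) → M.carrier → Prop}
    (hP : Represents M C (fun w : Fin (n + 1) → M.carrier =>
      P (fun i => w i.castSucc) (w (Fin.last n)))) :
    Represents M C (fun v => G (P v)) := by
  obtain ⟨cs, Xs, hP⟩ := hP
  refine ⟨cs, Xs, fun κ E hκ hE => ?_⟩
  obtain ⟨φ, hφ, hφ'⟩ := hP κ E hκ hE
  refine ⟨F (2 * n) φ, hC _ _ hφ, fun e he => ?_⟩
  rw [hF]
  simp only [hφ' _ (he.update n _), update_even_castSucc, Fin.val_last, Function.update_self]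

variable [CommSemiring M.carrier] [LinearOrder M.carrier]

/-- The operations and the order of `M` agree with the instances on its carrier. -/
structure Compatible (M : L2Structure.{u}) [CommSemiring M.carrier] [LinearOrder M.carrier] :
    Prop where
  zero : M.zero = 0
  one : M.one = 1
  add : ∀ a b, M.add a b = a + b
  mul : ∀ a b, M.mul a b = a * b
  le : ∀ a b, M.le a b ↔ a ≤ b

theorem Compatible.representsTerm (hM : Compatible M) {n : ℕ}
    {f : (Fin n → M.carrier) → M.carrier} (hf : Poly f) : RepresentsTerm M f := by
  induction hf with
  | var i =>
    exact ⟨[], fun κ _ => ⟨.var (2 * i), by simpa [Term.vars] using i.2.ne', fun e _ => rfl⟩⟩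
  | const c =>
    refine ⟨[c], fun κ hκ => ?_⟩
    obtain ⟨k, hk⟩ := hκ c (by simp)
    refine ⟨.var (2 * k + 1), ?_, fun e he => (he k).trans hk⟩
    simp only [Term.vars, Finset.mem_singleton]
    omega
  | add _ _ ihf ihg =>
    obtain ⟨cs, hf⟩ := ihf
    obtain ⟨cs', hg⟩ := ihg
    refine ⟨cs ++ cs', fun κ hκ => ?_⟩
    obtain ⟨s, hsv, hs⟩ := hf κ fun c hc => hκ c (by simp [hc])
    obtain ⟨t, htv, ht⟩ := hg κ fun c hc => hκ c (by simp [hc])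
    exact ⟨.add s t, by simp [Term.vars, hsv, htv], fun e he => by
      simp [L2Structure.eval, hM.add, hs e he, ht e he]⟩
  | mul _ _ ihf ihg =>
    obtain ⟨cs, hf⟩ := ihf
    obtain ⟨cs', hg⟩ := ihg
    refine ⟨cs ++ cs', fun κ hκ => ?_⟩
    obtain ⟨s, hsv, hs⟩ := hf κ fun c hc => hκ c (by simp [hc])
    obtain ⟨t, htv, ht⟩ := hg κ fun c hc => hκ c (by simp [hc])
    exact ⟨.mul s t, by simp [Term.vars, hsv, htv], fun e he => by
      simp [L2Structure.eval, hM.mul, hs e he, ht e he]⟩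

theorem Compatible.represents_delta0 (hM : Compatible M) {n : ℕ}
    {P : (Fin n → M.carrier) → Prop} (hP : Delta0 M.sets P) : Represents M IsDelta0 P := by
  induction hP with
  | eq hf hg =>
    exact .ofTerms Formula.eq (· = ·) .eq (fun _ _ _ _ => Iff.rfl) (hM.representsTerm hf)
      (hM.representsTerm hg)
  | le hf hg =>
    exact .ofTerms Formula.le (· ≤ ·) .le (fun _ _ _ _ => hM.le _ _) (hM.representsTerm hf)
      (hM.representsTerm hg)
  | mem X hf =>
    obtain ⟨cs, hf⟩ := hM.representsTerm hf
    refine ⟨cs, [X], fun κ E hκ hE => ?_⟩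
    obtain ⟨t, -, ht⟩ := hf κ hκ
    obtain ⟨k, rfl⟩ := hE X (by simp)
    exact ⟨.mem t k, .mem t k, fun e he => by simp only [L2Structure.Realize, ht e he]⟩
  | not _ ih =>
    obtain ⟨cs, Xs, h⟩ := ih
    refine ⟨cs, Xs, fun κ E hκ hE => ?_⟩
    obtain ⟨φ, hφ, h⟩ := h κ E hκ hE
    exact ⟨.neg φ, .neg hφ, fun e he => not_congr (h e he)⟩
  | and _ _ ihP ihQ =>
    exact .connective Formula.and And (fun _ _ => .and) (fun _ _ _ _ => Iff.rfl) ihP ihQ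
  | or _ _ ihP ihQ =>
    exact .connective Formula.or Or (fun _ _ => .or) (fun _ _ _ _ => Iff.rfl) ihP ihQ
  | imp _ _ ihP ihQ =>
    exact .connective Formula.imp (· → ·) (fun _ _ => .imp) (fun _ _ _ _ => Iff.rfl) ihP ihQ
  | ball ht _ ih =>
    refine .bounded (fun x t φ => .all x (.imp (.le (.var x) t) φ))
      (fun b R => ∀ a, a ≤ b → R a) (fun _ _ _ => .ball) (fun x t φ e E b hb => ?_)
      (hM.representsTerm ht) ih
    refine forall_congr' fun a => imp_congr_left ?_
    simp [L2Structure.Realize, L2Structure.eval, hM.le, hb]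
  | bex ht _ ih =>
    refine .bounded (fun x t φ => .ex x (.and (.le (.var x) t) φ))
      (fun b R => ∃ a, a ≤ b ∧ R a) (fun _ _ _ => .bex) (fun x t φ e E b hb => ?_)
      (hM.representsTerm ht) ih
    refine exists_congr fun a => and_congr_left' ?_
    simp [L2Structure.Realize, L2Structure.eval, hM.le, hb]

theorem Compatible.represents_sigma1 (hM : Compatible M) {n : ℕ}
    {P : (Fin n → M.carrier) → Prop} (hP : Sigma1 M.sets P) : Represents M (IsSigma 1) P := by
  induction hP with
  | delta0 hP => exact (hM.represents_delta0 hP).mono fun _ h => .of_pi (.delta0 h)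
  | ex _ ih =>
    exact .quantifier Formula.ex (fun R => ∃ a, R a)
      (fun x _ => IsSigma.ex x) (fun _ _ _ _ => Iff.rfl) ih

theorem Compatible.represents_pi1 (hM : Compatible M) {n : ℕ}
    {P : (Fin n → M.carrier) → Prop} (hP : Pi1 M.sets P) : Represents M (IsPi 1) P := by
  induction hP with
  | delta0 hP => exact (hM.represents_delta0 hP).mono fun _ h => .of_sigma (.delta0 h)
  | all _ ih =>
    exact .quantifier Formula.all (fun R => ∀ a, R a)
      (fun x _ => IsPi.all x) (fun _ _ _ _ => Iff.rfl) ih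

theorem Compatible.represents_sigma2 (hM : Compatible M) {n : ℕ}
    {P : (Fin n → M.carrier) → Prop} (hP : Sigma2 M.sets P) : Represents M (IsSigma 2) P := by
  induction hP with
  | pi1 hP => exact (hM.represents_pi1 hP).mono fun _ h => .of_pi h
  | ex _ ih =>
    exact .quantifier Formula.ex (fun R => ∃ a, R a)
      (fun x _ => IsSigma.ex x) (fun _ _ _ _ => Iff.rfl) ih

end Represents

-- From the axiom schemes to the semantic principles.

theorem exists_enumeration {α : Type u} [Nonempty α] (l : List α) :
    ∃ κ : ℕ → α, ∀ c ∈ l, ∃ k, κ k = c := by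
  refine ⟨fun k => l.getD k (Classical.arbitrary α), fun c hc => ?_⟩
  obtain ⟨k, hk, rfl⟩ := List.mem_iff_getElem.1 hc
  exact ⟨k, by simp [hk]⟩

/-- The assignment that gives the odd variables the values listed by `κ`. -/
theorem readsParams_half {α : Type u} (κ : ℕ → α) : ReadsParams κ (fun n => κ (n / 2)) :=
  fun k => congrArg κ (by omega)

theorem L2Structure.comprehension {M : L2Structure.{u}}
    (hax : ∀ τ ∈ delta1Comprehension, M.Holds τ) (P : M.carrier → Prop)
    (hP : Represents M (IsSigma 1) (fun v : Fin 1 → M.carrier => P (v 0)))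
    (hP' : Represents M (IsSigma 1) (fun v : Fin 1 → M.carrier => ¬ P (v 0))) :
    ∃ X : M.sets, ∀ x, x ∈ (X : Set M.carrier) ↔ P x := by
  obtain ⟨cs, Xs, h⟩ := hP
  obtain ⟨cs', Xs', h'⟩ := hP'
  have : Nonempty M.carrier := ⟨M.zero⟩
  have : Nonempty M.sets := M.sets_nonempty.to_subtype
  obtain ⟨κ, hκ⟩ := exists_enumeration (cs ++ cs')
  obtain ⟨E, hE⟩ := exists_enumeration (Xs ++ Xs')
  obtain ⟨φ, hφ, h⟩ := h κ E (fun c hc => hκ c (by simp [hc])) fun X hX => hE X (by simp [hX])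
  obtain ⟨ψ, hψ, h'⟩ := h' κ E (fun c hc => hκ c (by simp [hc])) fun X hX => hE X (by simp [hX])
  -- A fresh X meets the side condition of the scheme and leaves the truth of φ unchanged once X is
  -- assigned.
  obtain ⟨X, hX⟩ := Infinite.exists_notMem_finset φ.setVars
  have hpar := readsParams_half κ
  have hφP : ∀ a, M.Realize φ (Function.update (fun n => κ (n / 2)) 0 a) E ↔ P a := fun a => by
    rw [h _ (hpar.update 0 a)]; simp
  have hψP : ∀ a, M.Realize ψ (Function.update (fun n => κ (n / 2)) 0 a) E ↔ ¬ P a := fun a => by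
    rw [h' _ (hpar.update 0 a)]; simp
  obtain ⟨A, hA⟩ := hax _ ⟨φ, ψ, 0, X, hφ, hψ, hX, rfl⟩ (fun n => κ (n / 2)) E fun a =>
    ⟨fun ha hna => (hψP a).1 hna ((hφP a).1 ha), fun hna => (hφP a).2 (by
      by_contra hPa; exact hna ((hψP a).2 hPa))⟩
  refine ⟨A, fun x => ?_⟩
  have hx := hA x
  have h1 := M.realize_update_set A φ (Function.update (fun n => κ (n / 2)) 0 x) E hX
  rw [hφP] at h1
  rw [← h1]
  constructor
  · intro hxA
    exact hx.1 (by simpa [L2Structure.Realize, L2Structure.eval] using hxA)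
  · intro hxA
    simpa [L2Structure.Realize, L2Structure.eval] using hx.2 hxA

section Axioms

variable {M : L2Structure.{u}} [CommSemiring M.carrier] [LinearOrder M.carrier]

theorem Compatible.induction (hM : Compatible M) {n : ℕ}
    (hax : ∀ τ ∈ sigmaInd n, M.Holds τ) (P : M.carrier → Prop)
    (hP : Represents M (IsSigma n) (fun v : Fin 1 → M.carrier => P (v 0)))
    (h0 : P 0) (hs : ∀ x, P x → P (x + 1)) (x : M.carrier) : P x := by
  obtain ⟨cs, Xs, h⟩ := hP
  have : Nonempty M.carrier := ⟨M.zero⟩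
  have : Nonempty M.sets := M.sets_nonempty.to_subtype
  obtain ⟨κ, hκ⟩ := exists_enumeration cs
  obtain ⟨E, hE⟩ := exists_enumeration Xs
  obtain ⟨φ, hφ, h⟩ := h κ E hκ hE
  -- The auxiliary variable must be even, so that assigning it does not disturb the parameters.
  obtain ⟨y, hy0, hy⟩ : ∃ y : ℕ, 2 * y ≠ 0 ∧ 2 * y ∉ φ.numVars := by
    refine ⟨φ.numVars.sup id + 1, by omega, fun hmem => ?_⟩
    have := Finset.le_sup (f := id) hmem
    simp only [id] at this
    omega
  have hpar := readsParams_half κ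
  have hax := hax _ ⟨φ, 0, 2 * y, hφ, hy0, hy, rfl⟩ (fun n => κ (n / 2)) E
  have hreal : ∀ e a, ReadsParams κ e → (M.Realize φ (Function.update e 0 a) E ↔ P a) := by
    intro e a he
    rw [h _ (he.update 0 a)]
    simp
  refine (hreal _ x hpar).1 (hax ⟨fun a ha => ?_, fun a ha b hb a' ha' => ?_⟩ x)
  · rw [hreal _ a hpar]
    have : a = M.zero := by simpa [L2Structure.Realize, L2Structure.eval] using ha
    rwa [this, hM.zero]
  · rw [hreal _ a hpar] at ha
    rw [hreal _ a' ((hpar.update 0 a).update y b)]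
    have h1 : a' = b := by
      have := ha'
      simp only [L2Structure.Realize, L2Structure.eval, Function.update_self] at this
      rwa [Function.update_of_ne hy0, Function.update_self] at this
    have h2 : b = M.add a M.one := by
      have := hb
      simpa only [L2Structure.Realize, Function.update_self, L2Structure.eval, L2Structure.eval_add,
        L2Structure.eval_one, Function.update_of_ne hy0.symm] using this
    rw [h1, h2, hM.add, hM.one]
    exact hs a ha

end Axioms

-- The number sort as an ordered semiring, and the conclusion.

section Algebra

variable {M : L2Structure.{u}}

/-- The assignment `0 ↦ a`, `1 ↦ b`, `n ↦ c` for `n ≥ 2`. -/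
def assign {α : Type u} (a b c : α) : ℕ → α
  | 0 => a
  | 1 => b
  | _ => c

/-- Under a concrete assignment the truth of an axiom unfolds definitionally to the algebraic law,
so the axioms themselves can serve as the fields of the instances. -/
theorem L2Structure.realize_basic (h : ∀ τ ∈ basicAxioms, M.Holds τ) {φ : Formula}
    (hφ : φ ∈ basicAxioms) (a b c : M.carrier) :
    M.Realize φ (assign a b c) (fun _ => ⟨_, M.sets_nonempty.some_mem⟩) := h φ hφ _ _

open Term (var)

/-- The number sort as a commutative semiring. -/
abbrev L2Structure.commSemiring (h : ∀ τ ∈ basicAxioms, M.Holds τ) : CommSemiring M.carrier :=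
  have hadd_comm (a b) : M.add a b = M.add b a :=
    realize_basic h (φ := var 0 + var 1 ≐ var 1 + var 0) (by simp [basicAxioms]) a b a
  have hmul_comm (a b) : M.mul a b = M.mul b a :=
    realize_basic h (φ := var 0 * var 1 ≐ var 1 * var 0) (by simp [basicAxioms]) a b a
  have hadd_zero (a) : M.add a M.zero = a :=
    realize_basic h (φ := var 0 + 0 ≐ var 0) (by simp [basicAxioms]) a a a
  have hmul_zero (a) : M.mul a M.zero = M.zero :=
    realize_basic h (φ := var 0 * 0 ≐ 0) (by simp [basicAxioms]) a a a
  have hmul_one (a) : M.mul a M.one = a :=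
    realize_basic h (φ := var 0 * 1 ≐ var 0) (by simp [basicAxioms]) a a a
  have hmul_add (a b c) : M.mul a (M.add b c) = M.add (M.mul a b) (M.mul a c) :=
    realize_basic h (φ := var 0 * (var 1 + var 2) ≐ var 0 * var 1 + var 0 * var 2)
      (by simp [basicAxioms]) a b c
  { add := M.add
    zero := M.zero
    mul := M.mul
    one := M.one
    nsmul := @nsmulRec _ ⟨M.zero⟩ ⟨M.add⟩
    add_assoc := realize_basic h (φ := (var 0 + var 1) + var 2 ≐ var 0 + (var 1 + var 2))
      (by simp [basicAxioms])
    add_comm := hadd_comm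
    mul_assoc := realize_basic h (φ := (var 0 * var 1) * var 2 ≐ var 0 * (var 1 * var 2))
      (by simp [basicAxioms])
    mul_comm := hmul_comm
    add_zero := hadd_zero
    zero_add := fun a => (hadd_comm _ a).trans (hadd_zero a)
    mul_zero := hmul_zero
    zero_mul := fun a => (hmul_comm _ a).trans (hmul_zero a)
    mul_one := hmul_one
    one_mul := fun a => (hmul_comm _ a).trans (hmul_one a)
    left_distrib := hmul_add
    right_distrib := fun a b c => (hmul_comm _ c).trans ((hmul_add c a b).trans
      (congrArg₂ M.add (hmul_comm c a) (hmul_comm c b))) }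

/-- The order of the number sort. -/
noncomputable abbrev L2Structure.linearOrder (h : ∀ τ ∈ basicAxioms, M.Holds τ) :
    LinearOrder M.carrier where
  le := M.le
  le_refl a := realize_basic h (φ := var 0 ≼ var 0) (by simp [basicAxioms]) a a a
  le_trans a b c h₁ h₂ := realize_basic h
    (φ := var 0 ≼ var 1 ⋏ var 1 ≼ var 2 ⇒' var 0 ≼ var 2) (by simp [basicAxioms]) a b c ⟨h₁, h₂⟩
  le_antisymm a b h₁ h₂ := realize_basic h
    (φ := var 0 ≼ var 1 ⋏ var 1 ≼ var 0 ⇒' var 0 ≐ var 1) (by simp [basicAxioms]) a b a ⟨h₁, h₂⟩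
  le_total a b := realize_basic h
    (φ := var 0 ≼ var 1 ⋎ var 1 ≼ var 0) (by simp [basicAxioms]) a b a
  toDecidableLE := Classical.decRel _

theorem L2Structure.isStrictOrderedRing (h : ∀ τ ∈ basicAxioms, M.Holds τ) :
    letI := commSemiring h
    letI := linearOrder h
    IsStrictOrderedRing M.carrier ∧ CanonicallyOrderedAdd M.carrier ∧
      ∀ x : M.carrier, 0 < x → 1 ≤ x := by
  let := commSemiring h
  let := linearOrder h
  have hadd : ∀ a b c : M.carrier, a < b → a + c < b + c := fun a b c hab =>
    lt_iff_le_and_ne.2 (realize_basic h (φ := var 0 ≺ var 1 ⇒' var 0 + var 2 ≺ var 1 + var 2)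
      (by simp [basicAxioms]) a b c (lt_iff_le_and_ne.1 hab))
  have hmul : ∀ a b c : M.carrier, 0 < c → a < b → a * c < b * c := fun a b c hc hab =>
    lt_iff_le_and_ne.2 (realize_basic h
      (φ := 0 ≺ var 2 ⋏ var 0 ≺ var 1 ⇒' var 0 * var 2 ≺ var 1 * var 2)
      (by simp [basicAxioms]) a b c ⟨lt_iff_le_and_ne.1 hc, lt_iff_le_and_ne.1 hab⟩)
  have hsub : ∀ a b : M.carrier, a ≤ b → ∃ c, a + c = b := fun a b hab =>
    realize_basic h (φ := var 0 ≼ var 1 ⇒' .ex 2 (var 0 + var 2 ≐ var 1))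
      (by simp [basicAxioms]) a b a hab
  have hzero : ∀ a : M.carrier, 0 ≤ a := fun a =>
    realize_basic h (φ := 0 ≼ var 0) (by simp [basicAxioms]) a a a
  have hone : (0 : M.carrier) < 1 := lt_iff_le_and_ne.2
    (realize_basic h (φ := 0 ≺ 1) (by simp [basicAxioms]) 0 0 0)
  have hdisc : ∀ a : M.carrier, 0 < a → 1 ≤ a := fun a ha =>
    realize_basic h (φ := 0 ≺ var 0 ⇒' 1 ≼ var 0) (by simp [basicAxioms]) a a a
      (lt_iff_le_and_ne.1 ha)
  have hadd_le : ∀ a b c : M.carrier, a ≤ b → a + c ≤ b + c := fun a b c hab => by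
    rcases hab.lt_or_eq with hlt | rfl
    · exact (hadd a b c hlt).le
    · exact le_rfl
  have hself : ∀ a b : M.carrier, a ≤ a + b := fun a b => by
    have := hadd_le 0 b a (hzero b)
    rwa [zero_add, add_comm] at this
  refine ⟨?_, ?_, hdisc⟩
  · have : IsOrderedAddMonoid M.carrier := 
      ⟨fun a b hab c => hadd_le a b c hab, fun a b hab c => by
        rw [add_comm c, add_comm c]; exact hadd_le a b c hab⟩
    exact
      { le_of_add_le_add_left := fun a b c habc => not_lt.1 fun hlt => by
          have := hadd c b a hlt
          rw [add_comm c, add_comm b] at this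
          exact absurd habc (not_le.2 this)
        zero_le_one := hone.le
        exists_pair_ne := ⟨0, 1, hone.ne⟩
        mul_lt_mul_of_pos_left := fun a ha b c hbc => by
          have := hmul b c a ha hbc
          rwa [mul_comm b, mul_comm c] at this
        mul_lt_mul_of_pos_right := fun a ha b c hbc => hmul b c a ha hbc }
  · exact
      { exists_add_of_le := fun {a b} hab => (hsub a b hab).imp fun _ => Eq.symm
        le_self_add := hself
        le_add_self := fun a b => by rw [add_comm]; exact hself a b }

end Algebra

theorem L2Structure.konig (M : L2Structure.{u}) (h : ∀ τ ∈ RCA0 ∪ sigmaInd 2, M.Holds τ) :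
    M.Holds boundedWidthKonig := by
  have hb : ∀ τ ∈ basicAxioms, M.Holds τ := fun τ hτ => h τ (.inl (.inl (.inl hτ)))
  let := commSemiring hb
  let := linearOrder hb
  obtain ⟨h₁, h₂, hdisc⟩ := isStrictOrderedRing hb
  have hc : Compatible M := ⟨rfl, rfl, fun _ _ => rfl, fun _ _ => rfl, fun _ _ => Iff.rfl⟩
  have hM : Model M.carrier M.sets :=
    { one_le := hdisc
      comp := fun P hP hP' => comprehension (fun τ hτ => h τ (.inl (.inl (.inr hτ)))) P
        (hc.represents_sigma1 hP) (hc.represents_sigma1 hP')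
      ind1 := fun P hP => hc.induction (fun τ hτ => h τ (.inl (.inr hτ))) P
        (hc.represents_sigma1 hP)
      ind2 := fun P hP => hc.induction (fun τ hτ => h τ (.inr hτ)) P (hc.represents_sigma2 hP) }
  rintro e E Q V D ⟨⟨b, hQ⟩, hV, hD⟩ q₀ hlong
  -- The truth definition unfolds to the semantic statement; only the strict order, which the
  -- language expresses as ≤ and ≠, needs translation.
  obtain ⟨P, hP⟩ := hM.konig Q V D (b := b) hQ hV hD q₀ fun n => by
    obtain ⟨m, c, d, hnm, hq₀, ⟨h0, h0'⟩, hpath⟩ := hlong n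
    refine ⟨m, c, d, hnm, hq₀, ⟨lt_iff_le_and_ne.2 h0, h0'⟩, fun j hj => ?_⟩
    obtain ⟨v, w, ⟨hv, hv'⟩, ⟨hw, hw'⟩, hvw⟩ := hpath j (lt_iff_le_and_ne.1 hj)
    exact ⟨v, w, ⟨lt_iff_le_and_ne.2 hv, hv'⟩, ⟨lt_iff_le_and_ne.2 hw, hw'⟩, hvw⟩
  exact ⟨P, hP⟩

end SOA

theorem mainTheorem2 :
    SOA.Entails.{u} (SOA.RCA0 ∪ SOA.sigmaInd 2) SOA.boundedWidthKonig :=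
  fun M h => M.konig h
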